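/- Let $\mathrm{Nil}$ be the group of real matrices $\begin{pmatrix}1&x&z\\0&1&y\\0&0&1\end{pmatrix}$ with the left invariant metric $dx^2+dy^2+(dz-x\,dy)^2$, for which the basis $e_1=E_{12}$, $e_2=E_{23}$, $e_3=E_{13}$ of the Lie algebra is orthonormal; it is taken to be positively oriented. Let $\Omega\subset\mathbb C$ be open, with coordinate $z=x+iy$, $\partial=\frac12(\partial_x-i\partial_y)$, $\bar\partial=\frac12(\partial_x+i\partial_y)$. For a smooth map $f:\Omega\to\mathrm{Nil}$, a smooth $\psi=(\psi_1,\psi_2):\Omega\to\mathbb C^2$ is called a generating spinor of $f$ if $f^{-1}\partial f=Z_1e_1+Z_2e_2+Z_3e_3$ with $$Z_1=\tfrac i2(\bar\psi_2^2+\psi_1^2),\quad Z_2=\tfrac12(\bar\psi_2^2-\psi_1^2),\quad Z_3=\psi_1\bar\psi_2 .$$ For a real function $H$ on $\Omega$, the Dirac equation with $H$ is $$\left[\begin{pmatrix}0&\partial\\-\bar\partial&0\end{pmatrix}+\begin{pmatrix}U&0\\0&V\end{pmatrix}\right]\begin{pmatrix}\psi_1\\ \psi_2\end{pmatrix}=0,\qquad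 U=V=\frac H2(|\psi_1|^2+|\psi_2|^2)+\frac i4(|\psi_2|^2-|\psi_1|^2).\tag{D}$$ **Theorem.** (1) Let $f:\Omega\to\mathrm{Nil}$ be a smooth conformal immersion with induced metric $e^{2\alpha}dz\,d\bar z$, unit normal $N$ (such that $(f_x,f_y,N)$ is positively oriented), mean curvature $H$ (half the trace of the second fundamental form with respect to $N$) and Hopf differential $A\,dz^2$, $A=\langle\nabla_{f_z}f_z,N\rangle$, where $\nabla$ is the Levi-Civita connection. If $\Omega$ is simply connected, $f$ has a generating spinor. For every generating spinor $\psi$ of $f$ one has on $\Omega$: $e^{\alpha}=|\psi_1|^2+|\psi_2|^2$; the Dirac equation (D) with the mean curvature $H$; the remaining Weingarten equations $$\partial\psi_1=\alpha_z\psi_1+Ae^{-\alpha}\psi_2-\tfrac i2\psi_1^2\bar\psi_2,\qquad \bar\partial\psi_2=-\bar Ae^{-\alpha}\psi_1+\alpha_{\bar z}\psi_2-\tfrac i2\bar\psi_1\psi_2^2;$$ the formula $$A=(\bar\psi_2\partial\psi_1-\psi_1\partial\bar\psi_2)+i\psi_1^2\bar\psi_2^2$$ for the Hopf differential; and the Codazzi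 equations $$\alpha_{z\bar z}-e^{-2\alpha}|A|^2+\tfrac14e^{2\alpha}H^2=\tfrac3{16}e^{2\alpha}-|Z_3|^2,\qquad \bar\partial\Big(A+\frac{Z_3^2}{2H+i}\Big)=\tfrac12H_ze^{2\alpha}+\bar\partial\Big(\frac1{2H+i}\Big)Z_3^2 .$$ (2) Conversely, let $\Omega$ be simply connected, $H$ a real function on $\Omega$ and $\psi:\Omega\to\mathbb C^2$ a smooth solution of (D). Then for all $P\in\Omega$ and $g\in\mathrm{Nil}$ there is a smooth map $f:\Omega\to\mathrm{Nil}$ with $f(P)=g$ and generating spinor $\psi$; at every point where $\psi\neq0$ it is a conformal immersion whose mean curvature is $H$. In particular, if $\psi$ has no zeros, $\psi$ is the generating spinor of an immersed surface in $\mathrm{Nil}$ with mean curvature $H$. -/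

import Mathlib

open scoped ContDiff Matrix

noncomputable section

namespace NilSurface

/-! ### The group Nil and its left invariant metric -/

/-- The matrix with parameters `x, y, z` in the Heisenberg group. -/
def nilMatrix (x y z : ℝ) : Matrix (Fin 3) (Fin 3) ℝ :=
  !![1, x, z; 0, 1, y; 0, 0, 1]

/-- The group Nil of real upper unitriangular `3 × 3` matrices. -/
def Nil : Subgroup (Matrix.SpecialLinearGroup (Fin 3) ℝ) where
  carrier := {g | ∃ x y z : ℝ, (g : Matrix (Fin 3) (Fin 3) ℝ) = nilMatrix x y z}
  mul_mem' := by
    rintro a b ⟨x, y, z, ha⟩ ⟨x', y', z', hb⟩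
    refine ⟨x + x', y + y', z + z' + x * y', ?_⟩
    rw [Matrix.SpecialLinearGroup.coe_mul, ha, hb]
    ext i j
    fin_cases i <;> fin_cases j <;>
      simp [nilMatrix, Matrix.mul_apply, Fin.sum_univ_three] <;> ring
  one_mem' := by
    refine ⟨0, 0, 0, ?_⟩
    ext i j
    fin_cases i <;> fin_cases j <;> simp [nilMatrix]
  inv_mem' := by
    rintro a ⟨x, y, z, ha⟩
    refine ⟨-x, -y, x * y - z, ?_⟩
    rw [Matrix.SpecialLinearGroup.coe_inv, ha]
    ext i j
    fin_cases i <;> fin_cases j <;>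
      simp [nilMatrix, Matrix.adjugate_fin_three]

/-- The matrix of an element of Nil. -/
def mat (g : Nil) : Matrix (Fin 3) (Fin 3) ℝ := (g : Matrix.SpecialLinearGroup (Fin 3) ℝ)

/-- The basis `e₁, e₂, e₃` (indexed by `0, 1, 2`) of the Lie algebra of Nil. -/
def e : Fin 3 → Matrix (Fin 3) (Fin 3) ℝ :=
  ![!![0, 1, 0; 0, 0, 0; 0, 0, 0],
    !![0, 0, 0; 0, 0, 1; 0, 0, 0],
    !![0, 0, 1; 0, 0, 0; 0, 0, 0]]

/-- The coordinates of an element of the (complexified) Lie algebra in the basis `e`. -/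
def coord {R : Type*} (X : Matrix (Fin 3) (Fin 3) R) : Fin 3 → R :=
  ![X 0 1, X 1 2, X 0 2]

theorem coord_sum_e (v : Fin 3 → ℝ) : coord (∑ k, v k • e k) = v := by
  ext i
  fin_cases i <;> simp [coord, e, Fin.sum_univ_three]

/-- The left invariant metric on Nil for which `e₁, e₂, e₃` are orthonormal;
`X` and `Y` are vectors tangent to Nil at `g`. -/
def nilMetric (g : Nil) (X Y : Matrix (Fin 3) (Fin 3) ℝ) : ℝ :=
  coord (mat g⁻¹ * X) ⬝ᵥ coord (mat g⁻¹ * Y)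

/-- In coordinates the metric is `dx² + dy² + (dz - x dy)²`. -/
theorem nilMetric_eq (g : Nil) (x y z a b c a' b' c' : ℝ) (hg : mat g = nilMatrix x y z) :
    nilMetric g !![0, a, c; 0, 0, b; 0, 0, 0] !![0, a', c'; 0, 0, b'; 0, 0, 0] =
      a * a' + b * b' + (c - x * b) * (c' - x * b') := by
  have h : mat g⁻¹ = (nilMatrix x y z).adjugate := by
    rw [← hg]
    exact Matrix.SpecialLinearGroup.coe_inv _
  simp [nilMetric, h, coord, nilMatrix, Matrix.adjugate_fin_three, Matrix.mul_apply,
    Fin.sum_univ_three, dotProduct]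
  ring

/-! ### The Levi-Civita connection in the left invariant orthonormal frame -/

/-- `structureConst i j k = ⟨[e_i, e_j], e_k⟩`. -/
def structureConst (i j k : Fin 3) : ℝ := coord ⁅e i, e j⁆ k

/-- `leviCivita k j i` is the coefficient at `e_i` of `∇_{e_k} e_j`, given by the Koszul formula
for an orthonormal frame of left invariant vector fields. -/
def leviCivita (k j i : Fin 3) : ℝ :=
  (1 / 2) * (structureConst k j i + structureConst i k j + structureConst i j k)

theorem structureConst_antisymm (i j k : Fin 3) :
    structureConst i j k = -structureConst j i k := by
  simp only [structureConst, Ring.lie_def]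
  fin_cases k <;> simp [coord]

theorem leviCivita_torsionFree (k j i : Fin 3) :
    leviCivita k j i - leviCivita j k i = structureConst k j i := by
  have h := structureConst_antisymm k j i
  simp only [leviCivita]
  linarith

theorem leviCivita_metric (k j i : Fin 3) : leviCivita k j i + leviCivita k i j = 0 := by
  have h1 := structureConst_antisymm k j i
  have h2 := structureConst_antisymm k i j
  have h3 := structureConst_antisymm i j k
  simp only [leviCivita]
  linarith

/-! ### Derivatives -/

/-- `∂ = (∂_x - i ∂_y) / 2`. -/
def dz (h : ℂ → ℂ) (w : ℂ) : ℂ :=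
  (1 / 2) * (fderiv ℝ h w 1 - Complex.I * fderiv ℝ h w Complex.I)

/-- `∂̄ = (∂_x + i ∂_y) / 2`. -/
def dzbar (h : ℂ → ℂ) (w : ℂ) : ℂ :=
  (1 / 2) * (fderiv ℝ h w 1 + Complex.I * fderiv ℝ h w Complex.I)

/-- The derivative of `f` at `w` in the direction `v ∈ ℂ = ℝ²`, a vector tangent to Nil at `f w`.
The directions `1` and `Complex.I` give `f_x` and `f_y`. -/
def velocity (f : ℂ → Nil) (w v : ℂ) : Matrix (Fin 3) (Fin 3) ℝ :=
  Matrix.of fun i j => fderiv ℝ (fun u => mat (f u) i j) w v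

/-- The components of the derivative of `f` in the direction `v`
in the left invariant frame, i.e. the coordinates of `f⁻¹ df(v)`. -/
def leftVelocity (f : ℂ → Nil) (w v : ℂ) : Fin 3 → ℝ :=
  coord (mat (f w)⁻¹ * velocity f w v)

/-- `Ψ = f⁻¹ ∂f`. -/
def Psi (f : ℂ → Nil) (w : ℂ) : Matrix (Fin 3) (Fin 3) ℂ :=
  (mat (f w)⁻¹).map Complex.ofReal *
    Matrix.of fun i j => dz (fun u => (mat (f u) i j : ℂ)) w

/-! ### Surfaces in Nil -/

/-- `f` is smooth on the open set `Ω`. -/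
def IsSmooth (f : ℂ → Nil) (Ω : Set ℂ) : Prop :=
  ∀ i j, ContDiffOn ℝ ∞ (fun w => mat (f w) i j) Ω

/-- The derivative of `f` at `w` is injective and conformal. -/
def IsConformalAt (f : ℂ → Nil) (w : ℂ) : Prop :=
  0 < nilMetric (f w) (velocity f w 1) (velocity f w 1) ∧
  nilMetric (f w) (velocity f w 1) (velocity f w 1) =
    nilMetric (f w) (velocity f w Complex.I) (velocity f w Complex.I) ∧
  nilMetric (f w) (velocity f w 1) (velocity f w Complex.I) = 0

/-- `f : Ω → Nil` is a conformally parametrised immersed surface. -/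
def IsSurface (f : ℂ → Nil) (Ω : Set ℂ) : Prop :=
  IsSmooth f Ω ∧ ∀ w ∈ Ω, IsConformalAt f w

/-- `α`, where the induced metric of a conformally parametrised surface is `e^{2α} dz dz̄`. -/
def alpha (f : ℂ → Nil) (w : ℂ) : ℝ :=
  Real.log (nilMetric (f w) (velocity f w 1) (velocity f w 1)) / 2

/-- The components in the left invariant frame of the unit normal field of the surface; together
with `f_x, f_y` it is positively oriented, the frame `e₁, e₂, e₃` being positive. -/
def normal (f : ℂ → Nil) (w : ℂ) : Fin 3 → ℝ :=
  let n := crossProduct (leftVelocity f w 1) (leftVelocity f w Complex.I)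
  (Real.sqrt (n ⬝ᵥ n))⁻¹ • n

/-- The components of the covariant derivative in the direction `v ∈ ℂ = ℝ²` of a vector
field along `f` that has the components `X` in the left invariant frame. -/
def covDeriv (f : ℂ → Nil) (X : ℂ → Fin 3 → ℝ) (w v : ℂ) : Fin 3 → ℝ := fun i =>
  fderiv ℝ (fun u => X u i) w v +
    ∑ k, ∑ j, leftVelocity f w v k * X w j * leviCivita k j i

/-- The second fundamental form: `⟨∇_v df(u), N⟩` at the point `w`. -/
def secondForm (f : ℂ → Nil) (w v u : ℂ) : ℝ :=
  covDeriv f (fun p => leftVelocity f p u) w v ⬝ᵥ normal f w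

/-- The mean curvature, half the trace of the second fundamental form
with respect to the first one. -/
def meanCurvature (f : ℂ → Nil) (w : ℂ) : ℝ :=
  let E := nilMetric (f w) (velocity f w 1) (velocity f w 1)
  let F := nilMetric (f w) (velocity f w 1) (velocity f w Complex.I)
  let G := nilMetric (f w) (velocity f w Complex.I) (velocity f w Complex.I)
  (E * secondForm f w Complex.I Complex.I - 2 * F * secondForm f w 1 Complex.I +
    G * secondForm f w 1 1) / (2 * (E * G - F ^ 2))

/-- The coefficient `A = ⟨∇_{f_z} f_z, N⟩` of the Hopf quadratic differential `A dz²`; the metric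
and the connection are extended complex linearly. -/
def hopf (f : ℂ → Nil) (w : ℂ) : ℂ :=
  ∑ i, (dz (fun u => coord (Psi f u) i) w +
    ∑ j, ∑ k, coord (Psi f w) j * coord (Psi f w) k * (leviCivita j k i : ℂ)) *
      (normal f w i : ℂ)

/-! ### Spinors -/

/-- The null vector `(Z₁, Z₂, Z₃)` parametrised by `(ψ₁, ψ₂) = (a, b)`. -/
def spinorZ (a b : ℂ) : Fin 3 → ℂ :=
  ![Complex.I / 2 * (star b ^ 2 + a ^ 2), 1 / 2 * (star b ^ 2 - a ^ 2), a * star b]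

/-- `ψ = (ψ₁, ψ₂)` is a generating spinor of `f` on `Ω`: it is smooth and
`f⁻¹ ∂f = Z₁ e₁ + Z₂ e₂ + Z₃ e₃`. -/
def IsGeneratingSpinor (f : ℂ → Nil) (Ω : Set ℂ) (ψ₁ ψ₂ : ℂ → ℂ) : Prop :=
  ContDiffOn ℝ ∞ ψ₁ Ω ∧ ContDiffOn ℝ ∞ ψ₂ Ω ∧
  ∀ w ∈ Ω, Psi f w = ∑ k, spinorZ (ψ₁ w) (ψ₂ w) k • (e k).map Complex.ofReal

/-- The Dirac operator with potentials `U, V`: the vector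
`((0, ∂; -∂̄, 0) + (U, 0; 0, V)) (ψ₁, ψ₂)`. -/
def dirac (U V ψ₁ ψ₂ : ℂ → ℂ) (w : ℂ) : Fin 2 → ℂ :=
  ![dz ψ₂ w + U w * ψ₁ w, -dzbar ψ₁ w + V w * ψ₂ w]

/-- The potential `U = V` of the Dirac operator for surfaces in Nil. -/
def nilPotential (H : ℂ → ℝ) (ψ₁ ψ₂ : ℂ → ℂ) (w : ℂ) : ℂ :=
  (H w : ℂ) / 2 * ((‖ψ₁ w‖ : ℂ) ^ 2 + (‖ψ₂ w‖ : ℂ) ^ 2) +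
    Complex.I / 4 * ((‖ψ₂ w‖ : ℂ) ^ 2 - (‖ψ₁ w‖ : ℂ) ^ 2)

/-- `ψ` satisfies the Dirac equation for Nil with the function `H` at `w`. -/
def NilDirac (H : ℂ → ℝ) (ψ₁ ψ₂ : ℂ → ℂ) (w : ℂ) : Prop :=
  dirac (nilPotential H ψ₁ ψ₂) (nilPotential H ψ₁ ψ₂) ψ₁ ψ₂ w = 0

end NilSurface

end

/-! Write Z for the coordinates of `f⁻¹ ∂f`. Since f_x - i f_y corresponds to 2Z, conformality of f
says Z₁² + Z₂² + Z₃² = 0, and immersivity says Z ≠ 0. The null cone factors as (-iZ₁ - Z₂)(-iZ₁ +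
Z₂) = Z₃², so a generating spinor is a simultaneous square root (ψ₁, ψ̄₂) of the two factors with
product Z₃ (`spinorZ_eq_iff`). Locally it exists and is unique up to sign; on a simply connected
domain the signs can be matched (`exists_sqrt_pair`).

Given ψ, the metric, the normal, A and H are explicit in ψ and its first derivatives
(`nilMetric_eq`, `normal_eq`, `hopf_eq`, `meanCurvature_mul`). The three real Maurer-Cartan
equations and the real formula for H form a linear system for ∂̄ψ₁ and ∂ψ₂ with determinant e^α; its
solution is the Dirac equation. Likewise ∂α and A determine ∂ψ₁ and ∂ψ̄₂, which are the Weingarten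
equations. Differentiating the Dirac equation and commuting ∂ with ∂̄ gives the mixed second
derivatives of ψ, and then `gauss` and `codazzi` are algebraic identities.

Conversely the Dirac equation makes the forms belonging to Z₁, Z₂ and Z₃ + xZ₂ closed. Their
primitives x, y, z are the matrix entries of f, and `meanCurvature_mul`, read backwards, returns H.

Both global steps, primitives and square roots, use one gluing principle: local solutions that form
a torsor under a discrete group glue over a simply connected domain, because coverings of it have
sections. -/

noncomputable section

namespace NilSurface

open Complex Filter Topology ComplexConjugate

section

/-! ### Wirtinger calculus -/

/-- The real linear map `v ↦ p v + q v̄`. -/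
def wirtingerMap (p q : ℂ) : ℂ →L[ℝ] ℂ :=
  ContinuousLinearMap.mul ℝ ℂ p + (ContinuousLinearMap.mul ℝ ℂ q).comp conjCLE.toContinuousLinearMap

@[simp] theorem wirtingerMap_apply (p q v : ℂ) : wirtingerMap p q v = p * v + q * conj v := by
  simp [wirtingerMap]

/-- `h` has the Wirtinger derivatives `∂h = p` and `∂̄h = q` at `w`. -/
def HasWirtinger (h : ℂ → ℂ) (p q w : ℂ) : Prop := HasFDerivAt h (wirtingerMap p q) w

theorem _root_.ContinuousLinearMap.ext_one_I {F : Type*} [NormedAddCommGroup F] [NormedSpace ℝ F]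
    {L M : ℂ →L[ℝ] F} (h1 : L 1 = M 1) (hI : L I = M I) : L = M := by
  ext v
  have hv : v = v.re • (1 : ℂ) + v.im • I := by
    simp
  rw [hv, map_add, map_add, map_smul, map_smul, map_smul, map_smul, h1, hI]

namespace HasWirtinger

variable {h k : ℂ → ℂ} {p q r s w : ℂ}

theorem dz_eq (H : HasWirtinger h p q w) : dz h w = p := by
  rw [dz, HasFDerivAt.fderiv H]
  simp only [wirtingerMap_apply, map_one, conj_I]
  linear_combination (-p / 2 + q / 2) * I_mul_I

theorem dzbar_eq (H : HasWirtinger h p q w) : dzbar h w = q := by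
  rw [dzbar, HasFDerivAt.fderiv H]
  simp only [wirtingerMap_apply, map_one, conj_I]
  linear_combination (p / 2 - q / 2) * I_mul_I

theorem congr_of_eventuallyEq (H : HasWirtinger h p q w) (e : k =ᶠ[𝓝 w] h) :
    HasWirtinger k p q w :=
  HasFDerivAt.congr_of_eventuallyEq H e

theorem congr_deriv (H : HasWirtinger h p q w) (hp : p = r) (hq : q = s) :
    HasWirtinger h r s w := hp ▸ hq ▸ H

theorem const (c w : ℂ) : HasWirtinger (fun _ => c) 0 0 w := by
  have : wirtingerMap 0 0 = 0 := by ext v; simp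
  rw [HasWirtinger, this]
  exact hasFDerivAt_const c w

theorem of_hasFDerivAt {L : ℂ →L[ℝ] ℂ} (H : HasFDerivAt h L w) (e : ∀ v, L v = p * v + q * conj v) :
    HasWirtinger h p q w := by
  have : L = wirtingerMap p q := by ext v; simp [e]
  rw [HasWirtinger, ← this]
  exact H

theorem add (H : HasWirtinger h p q w) (K : HasWirtinger k r s w) :
    HasWirtinger (fun u => h u + k u) (p + r) (q + s) w :=
  of_hasFDerivAt (HasFDerivAt.add H K) fun v => by simp; ring

theorem sub (H : HasWirtinger h p q w) (K : HasWirtinger k r s w) :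
    HasWirtinger (fun u => h u - k u) (p - r) (q - s) w :=
  of_hasFDerivAt (HasFDerivAt.sub H K) fun v => by simp; ring

theorem mul (H : HasWirtinger h p q w) (K : HasWirtinger k r s w) :
    HasWirtinger (fun u => h u * k u) (h w * r + p * k w) (h w * s + q * k w) w :=
  of_hasFDerivAt (HasFDerivAt.mul H K) fun v => by simp; ring

theorem const_mul (c : ℂ) (H : HasWirtinger h p q w) :
    HasWirtinger (fun u => c * h u) (c * p) (c * q) w :=
  ((const c w).mul H).congr_deriv (by ring) (by ring)

theorem sq (H : HasWirtinger h p q w) :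
    HasWirtinger (fun u => h u ^ 2) (2 * h w * p) (2 * h w * q) w := by
  simp only [pow_two]
  exact (H.mul H).congr_deriv (by ring) (by ring)

theorem conjugate (H : HasWirtinger h p q w) :
    HasWirtinger (fun u => conj (h u)) (conj q) (conj p) w :=
  of_hasFDerivAt (conjCLE.toContinuousLinearMap.hasFDerivAt.comp w H) fun v => by
    simp; ring

theorem inv (H : HasWirtinger h p q w) (h0 : h w ≠ 0) :
    HasWirtinger (fun u => (h u)⁻¹) (-p / h w ^ 2) (-q / h w ^ 2) w :=
  of_hasFDerivAt (((hasDerivAt_inv h0).hasFDerivAt.restrictScalars ℝ).comp w H) fun v => by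
    simp; field_simp; ring

theorem div (H : HasWirtinger h p q w) (K : HasWirtinger k r s w) (k0 : k w ≠ 0) :
    HasWirtinger (fun u => h u / k u) ((p * k w - h w * r) / k w ^ 2)
      ((q * k w - h w * s) / k w ^ 2) w := by
  simp only [div_eq_mul_inv]
  exact (H.mul (K.inv k0)).congr_deriv (by field_simp; ring) (by field_simp; ring)

theorem fderiv_apply (H : HasWirtinger h p q w) (v : ℂ) :
    fderiv ℝ h w v = p * v + q * conj v := by
  rw [HasFDerivAt.fderiv H, wirtingerMap_apply]

theorem differentiableAt_of_ofReal {g : ℂ → ℝ} (H : HasWirtinger (fun u => (g u : ℂ)) p q w) :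
    DifferentiableAt ℝ g w := by
  simpa [Function.comp_def] using
    (reCLM.hasFDerivAt.comp w H : HasFDerivAt (fun u => reCLM (g u : ℂ)) _ w).differentiableAt

theorem ofReal_fderiv_apply {g : ℂ → ℝ} (H : HasWirtinger (fun u => (g u : ℂ)) p q w) (v : ℂ) :
    ((fderiv ℝ g w v : ℝ) : ℂ) = p * v + q * conj v := by
  have h : fderiv ℝ (fun u => (g u : ℂ)) w = _ :=
    (ofRealCLM.hasFDerivAt.comp w H.differentiableAt_of_ofReal.hasFDerivAt).fderiv
  rw [← H.fderiv_apply, h]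
  rfl

theorem ofReal_log {g : ℂ → ℝ} (H : HasWirtinger (fun u => (g u : ℂ)) p q w) (h0 : g w ≠ 0) :
    HasWirtinger (fun u => ((Real.log (g u) : ℝ) : ℂ)) (p / g w) (q / g w) w :=
  of_hasFDerivAt (ofRealCLM.hasFDerivAt.comp w
    (H.differentiableAt_of_ofReal.hasFDerivAt.log h0)) fun v => by
      simp only [ContinuousLinearMap.comp_apply, _root_.smul_apply, smul_eq_mul,
        ofRealCLM_apply, ofReal_mul, ofReal_inv, H.ofReal_fderiv_apply]
      ring

end HasWirtinger

theorem _root_.DifferentiableAt.hasWirtinger {h : ℂ → ℂ} {w : ℂ} (H : DifferentiableAt ℝ h w) :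
    HasWirtinger h (dz h w) (dzbar h w) w := by
  have : fderiv ℝ h w = wirtingerMap (dz h w) (dzbar h w) := by
    apply ContinuousLinearMap.ext_one_I
    · simp [dz, dzbar]; ring
    · simp only [dz, dzbar, wirtingerMap_apply, conj_I]
      linear_combination (fderiv ℝ h w I) * I_mul_I
  rw [HasWirtinger, ← this]
  exact H.hasFDerivAt

variable {Ω : Set ℂ} {h : ℂ → ℂ}

theorem _root_.ContDiffOn.hasWirtinger {w : ℂ} (H : ContDiffOn ℝ ∞ h Ω) (hΩ : IsOpen Ω)
    (hw : w ∈ Ω) : HasWirtinger h (dz h w) (dzbar h w) w :=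
  ((H.contDiffAt (hΩ.mem_nhds hw)).differentiableAt (by simp)).hasWirtinger

theorem _root_.ContDiffOn.fderiv_apply_of_isOpen {F : Type*} [NormedAddCommGroup F]
    [NormedSpace ℝ F] {g : ℂ → F} (H : ContDiffOn ℝ ∞ g Ω) (hΩ : IsOpen Ω) (v : ℂ) :
    ContDiffOn ℝ ∞ (fun w => fderiv ℝ g w v) Ω :=
  (H.fderiv_of_isOpen hΩ (by simp)).clm_apply contDiffOn_const

theorem _root_.ContDiffOn.dz (H : ContDiffOn ℝ ∞ h Ω) (hΩ : IsOpen Ω) :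
    ContDiffOn ℝ ∞ (dz h) Ω :=
  contDiffOn_const.mul ((H.fderiv_apply_of_isOpen hΩ 1).sub
    (contDiffOn_const.mul (H.fderiv_apply_of_isOpen hΩ I)))

theorem _root_.ContDiffOn.dzbar (H : ContDiffOn ℝ ∞ h Ω) (hΩ : IsOpen Ω) :
    ContDiffOn ℝ ∞ (dzbar h) Ω :=
  contDiffOn_const.mul ((H.fderiv_apply_of_isOpen hΩ 1).add
    (contDiffOn_const.mul (H.fderiv_apply_of_isOpen hΩ I)))

theorem _root_.ContDiffOn.conjugate (H : ContDiffOn ℝ ∞ h Ω) :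
    ContDiffOn ℝ ∞ (fun w => conj (h w)) Ω :=
  conjCLE.contDiff.comp_contDiffOn H

theorem _root_.ContDiffOn.complex_ofReal {g : ℂ → ℝ} (H : ContDiffOn ℝ ∞ g Ω) :
    ContDiffOn ℝ ∞ (fun w => (g w : ℂ)) Ω :=
  ofRealCLM.contDiff.comp_contDiffOn H

/-- `∂` and `∂̄` commute. -/
theorem dzbar_dz (H : ContDiffOn ℝ ∞ h Ω) (hΩ : IsOpen Ω) {w : ℂ} (hw : w ∈ Ω) :
    dzbar (dz h) w = dz (dzbar h) w := by
  have two_le : (2 : WithTop ℕ∞) ≤ ∞ := WithTop.coe_le_coe.2 (le_top : (2 : ℕ∞) ≤ ⊤)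
  have hC := H.contDiffAt (hΩ.mem_nhds hw)
  have hsymm : IsSymmSndFDerivAt ℝ h w :=
    hC.isSymmSndFDerivAt (by simpa using two_le)
  have hd : DifferentiableAt ℝ (fderiv ℝ h) w :=
    (hC.fderiv_right (m := 1) (by rw [one_add_one_eq_two]; exact two_le)).differentiableAt (by simp)
  have key : ∀ v, HasFDerivAt (fun u => fderiv ℝ h u v)
      ((ContinuousLinearMap.apply ℝ ℂ v).comp (fderiv ℝ (fderiv ℝ h) w)) w := fun v =>
    (ContinuousLinearMap.apply ℝ ℂ v).hasFDerivAt.comp w hd.hasFDerivAt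
  have e1 := (((key 1).sub ((key I).const_mul I)).const_mul (1 / 2)).fderiv
  have e2 := (((key 1).add ((key I).const_mul I)).const_mul (1 / 2)).fderiv
  have s := hsymm.eq 1 I
  have e1' : fderiv ℝ (dz h) w = _ := e1
  have e2' : fderiv ℝ (dzbar h) w = _ := e2
  rw [dzbar, dz, e1', e2']
  simp [s]
  ring

end

section

/-! ### Gluing over simply connected domains -/

open Set in
/-- On a simply connected, locally path connected space every locally constant cocycle is a
coboundary. -/
theorem exists_trivialization_of_cocycle {X ι G : Type*} [TopologicalSpace X]
    [SimplyConnectedSpace X] [LocallyPathConnectedSpace X] [Group G] (U : ι → Set X)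
    (hU : ∀ i, IsOpen (U i)) (hcover : ∀ x, ∃ i, x ∈ U i) (c : ι → ι → X → G)
    (hself : ∀ i, ∀ x ∈ U i, c i i x = 1)
    (hcomp : ∀ i j k, ∀ x ∈ U i ∩ U j ∩ U k, c i j x * c j k x = c i k x)
    (hloc : ∀ i j, ∀ x ∈ U i ∩ U j, ∀ᶠ y in 𝓝 x, c i j y = c i j x) :
    ∃ g : ι → X → G, (∀ i, ∀ x ∈ U i, ∀ᶠ y in 𝓝 x, g i y = g i x) ∧
      ∀ i j, ∀ x ∈ U i ∩ U j, g j x = g i x * c i j x := by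
  -- With the discrete topology on the fibre, the cocycle acting by right multiplication defines a
  -- covering space. A trivialization is a global section of it, and continuity into a discrete
  -- fibre is local constancy.
  let : TopologicalSpace G := ⊥
  have : DiscreteTopology G := ⟨rfl⟩
  choose idx hidx using hcover
  let Z : FiberBundleCore ι X G :=
    { baseSet := U
      isOpen_baseSet := hU
      indexAt := idx
      mem_baseSet_at := hidx
      coordChange := fun i j x v => v * c i j x
      coordChange_self := fun i x hx v => by rw [hself i x hx, mul_one]
      continuousOn_coordChange := by
        rintro i j ⟨x, v⟩ ⟨hx, -⟩
        have h1 : ∀ᶠ p : X × G in 𝓝 (x, v), c i j p.1 = c i j x :=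
          (continuous_fst.tendsto (x, v)).eventually (hloc i j x hx)
        have h2 : ∀ᶠ p : X × G in 𝓝 (x, v), p.2 = v :=
          (continuous_snd.tendsto (x, v)).eventually (p := fun u => u = v) (by simp [nhds_discrete])
        have h0 : ContinuousAt (fun _ : X × G => v * c i j x) (x, v) := continuousAt_const
        refine ContinuousAt.continuousWithinAt (h0.congr ?_)
        filter_upwards [h1, h2] with p hp1 hp2
        rw [hp1, hp2]
      coordChange_comp := fun i j k x hx v => by rw [mul_assoc, hcomp i j k x hx] }
  have cov : IsCoveringMap Z.proj :=
    IsFiberBundle.isCoveringMap fun x => ⟨Z.localTriv (idx x), hidx x⟩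
  obtain ⟨x₀⟩ : Nonempty X := inferInstance
  -- Lifting the identity of the simply connected base gives the section.
  obtain ⟨S, ⟨-, hS⟩, -⟩ := cov.existsUnique_continuousMap_lifts (ContinuousMap.id X) x₀
    (⟨x₀, (1 : G)⟩ : Z.TotalSpace) rfl
  have hS' : ∀ x, Z.proj (S x) = x := fun x => congrFun hS x
  have hS1 : ∀ x, (S x).1 = x := hS'
  refine ⟨fun i x => (Z.localTriv i (S x)).2, fun i x hx => ?_, fun i j x hx => ?_⟩
  · have hmem : S x ∈ (Z.localTriv i).source := by
      change (S x).1 ∈ U i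
      rwa [hS1]
    have hcont : ContinuousAt (fun y => (Z.localTriv i (S y)).2) x :=
      continuousAt_snd.comp (((Z.localTriv i).continuousOn_toFun.continuousAt
        ((Z.localTriv i).open_source.mem_nhds hmem)).comp S.continuous.continuousAt)
    have := hcont.tendsto
    rw [nhds_discrete G, tendsto_pure] at this
    exact this
  · let v : G := (S x).2
    change v * c (idx (S x).1) j (S x).1 = v * c (idx (S x).1) i (S x).1 * c i j x
    rw [hS1, mul_assoc, hcomp _ _ _ x ⟨⟨hidx x, hx.1⟩, hx.2⟩]

/-- Local maps to a space with a free group action that differ by locally constant group elements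
glue, up to such elements, to a map on a simply connected domain. -/
theorem _root_.IsSimplyConnected.exists_glue {Ω : Set ℂ} (hΩ : IsOpen Ω)
    (hsc : IsSimplyConnected Ω) {ι G M : Type*} [Group G] [MulAction G M] (U : ι → Set ℂ)
    (hU : ∀ i, IsOpen (U i)) (hcover : ∀ w ∈ Ω, ∃ i, w ∈ U i) (s : ι → ℂ → M)
    (hfree : ∀ i, ∀ w ∈ U i, ∀ g : G, g • s i w = s i w → g = 1)
    (hs : ∀ i j, ∀ w ∈ U i ∩ U j, ∃ g : G, ∀ᶠ u in 𝓝 w, s i u = g • s j u) :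
    ∃ S : ℂ → M, ∀ w ∈ Ω, ∃ i, w ∈ U i ∧ ∃ g : G, ∀ᶠ u in 𝓝 w, S u = g • s i u := by
  classical
  have := hsc.simplyConnectedSpace
  have := hΩ.locallyPathConnectedSpace
  have hval : ∀ i j, ∀ w ∈ U i ∩ U j, ∃ g : G, s i w = g • s j w := fun i j w hw =>
    (hs i j w hw).imp fun g hg => hg.self_of_nhds
  -- The transition element is chosen pointwise. Freeness makes it unique on overlaps, which yields
  -- both the cocycle identity and local constancy.
  let c : ι → ι → Ω → G := fun i j x =>
    if h : ∃ g : G, s i x = g • s j x then h.choose else 1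
  have hc : ∀ i j, ∀ x : Ω, (x : ℂ) ∈ U i ∩ U j → s i x = c i j x • s j x := fun i j x hx => by
    have h := hval i j x hx
    simp only [c, dif_pos h]
    exact h.choose_spec
  have huniq : ∀ i, ∀ w ∈ U i, ∀ g g' : G, g • s i w = g' • s i w → g = g' := by
    intro i w hw g g' h
    have := hfree i w hw (g'⁻¹ * g) (by rw [mul_smul, h, inv_smul_smul])
    exact (inv_mul_eq_one.mp this).symm
  obtain ⟨g, hg1, hg2⟩ := exists_trivialization_of_cocycle (fun i => ((↑) : Ω → ℂ) ⁻¹' U i)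
    (fun i => (hU i).preimage continuous_subtype_val) (fun x => hcover x x.2) c
    (fun i x hx => huniq i x hx _ _ (by rw [← hc i i x ⟨hx, hx⟩, one_smul]))
    (fun i j k x hx => huniq k x hx.2 _ _ (by
      rw [mul_smul, ← hc j k x ⟨hx.1.2, hx.2⟩, ← hc i j x hx.1, hc i k x ⟨hx.1.1, hx.2⟩]))
    (fun i j x hx => by
      obtain ⟨g, hg⟩ := hs i j x hx
      have hx' : ∀ᶠ u in 𝓝 (x : ℂ), u ∈ U i ∩ U j := ((hU i).inter (hU j)).mem_nhds hx
      have key : ∀ y : Ω, (y : ℂ) ∈ U i ∩ U j → s i y = g • s j y → c i j y = g :=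
        fun y hy h => huniq j y hy.2 _ _ (by rw [← hc i j y hy, h])
      rw [key x hx hg.self_of_nhds]
      exact (continuous_subtype_val.continuousAt.eventually (hx'.and hg)).mono
        fun y hy => key y hy.1 hy.2)
  obtain ⟨w₀, hw₀⟩ := hsc.nonempty
  have : Nonempty ι := ⟨(hcover w₀ hw₀).choose⟩
  choose! idx hidx using hcover
  -- The value does not depend on the chosen index, since g_j • s_j = (g_i c_ij) • s_j = g_i • s_i.
  refine ⟨fun w => if h : w ∈ Ω then g (idx w) ⟨w, h⟩ • s (idx w) w else s (idx w) w,
    fun w hw => ⟨idx w, hidx w hw, g (idx w) ⟨w, hw⟩, ?_⟩⟩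
  have h1 := (hg1 (idx w) ⟨w, hw⟩ (hidx w hw))
  rw [nhds_subtype, eventually_comap] at h1
  filter_upwards [h1, hΩ.mem_nhds hw, (hU (idx w)).mem_nhds (hidx w hw)] with u hu huΩ hui
  rw [dif_pos huΩ, ← hu ⟨u, huΩ⟩ rfl, hg2 (idx u) (idx w) ⟨u, huΩ⟩ ⟨hidx u huΩ, hui⟩, mul_smul,
    ← hc (idx u) (idx w) ⟨u, huΩ⟩ ⟨hidx u huΩ, hui⟩]

end

section

/-! ### Primitives of closed forms -/

/-- The real linear form `v ↦ 2 Re (c v)`, as a function of `c`. -/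
def reForm : ℂ →L[ℝ] ℂ →L[ℝ] ℝ :=
  (2 : ℝ) • (ContinuousLinearMap.compL ℝ ℂ ℂ ℝ reCLM).comp (ContinuousLinearMap.mul ℝ ℂ)

theorem reForm_apply (c v : ℂ) : reForm c v = 2 * (c * v).re := by
  simp [reForm]

theorem hasWirtinger_of_hasFDerivAt_reForm {x : ℂ → ℝ} {c w : ℂ}
    (H : HasFDerivAt x (reForm c) w) : HasWirtinger (fun u => (x u : ℂ)) c (conj c) w :=
  HasWirtinger.of_hasFDerivAt (ofRealCLM.hasFDerivAt.comp w H) fun v => by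
    simp only [ContinuousLinearMap.comp_apply, reForm_apply, ofRealCLM_apply, ofReal_mul,
      ofReal_ofNat, re_eq_add_conj, map_mul]
    ring

theorem eventually_eq_add_of_hasFDerivAt {E : Type*} [NormedAddCommGroup E] [NormedSpace ℝ E]
    {F G : E → ℝ} {U : Set E} {w : E} {L : E → E →L[ℝ] ℝ} (hU : U ∈ 𝓝 w)
    (hF : ∀ u ∈ U, HasFDerivAt F (L u) u) (hG : ∀ u ∈ U, HasFDerivAt G (L u) u) :
    ∀ᶠ u in 𝓝 w, F u = (F w - G w) + G u := by
  obtain ⟨r, hr, hrU⟩ := Metric.mem_nhds_iff.mp hU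
  have hd : ∀ u ∈ Metric.ball w r, HasFDerivAt (fun u => F u - G u) 0 u := fun u hu => by
    have := (hF u (hrU hu)).sub (hG u (hrU hu))
    rw [sub_self] at this
    exact this
  filter_upwards [Metric.ball_mem_nhds w hr] with u hu
  have := Metric.isOpen_ball.is_const_of_fderiv_eq_zero (convex_ball w r).isPreconnected
    (fun u hu => (hd u hu).differentiableAt.differentiableWithinAt)
    (fun u hu => (hd u hu).fderiv) hu (Metric.mem_ball_self hr)
  linarith

/-- The antisymmetric part of the derivative of h dz + h̄ dz̄ is a multiple of Im ∂̄h, so reality of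
∂̄h is closedness, and the Poincaré lemma applies on the convex ball. -/
theorem exists_primitive_ball {h : ℂ → ℂ} {c : ℂ} {r : ℝ}
    (hh : ContDiffOn ℝ ∞ h (Metric.ball c r))
    (hreal : ∀ w ∈ Metric.ball c r, conj (dzbar h w) = dzbar h w) :
    ∃ F : ℂ → ℝ, ∀ w ∈ Metric.ball c r, HasFDerivAt F (reForm (h w)) w := by
  have hd : ∀ w ∈ Metric.ball c r, HasFDerivAt (fun u => reForm (h u))
      (reForm.comp (wirtingerMap (dz h w) (dzbar h w))) w := fun w hw =>
    reForm.hasFDerivAt.comp w (hh.hasWirtinger Metric.isOpen_ball hw)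
  refine (convex_ball c r).exists_forall_hasFDerivAt_of_fderiv_symmetric Metric.isOpen_ball
    (fun w hw => (hd w hw).differentiableAt.differentiableWithinAt) fun w hw x y => ?_
  have him := conj_eq_iff_im.mp (hreal w hw)
  rw [(hd w hw).fderiv]
  simp only [ContinuousLinearMap.comp_apply, reForm_apply, wirtingerMap_apply, mul_re, mul_im,
    add_re, add_im, conj_re, conj_im, him]
  ring

/-- A smooth closed real form `h dz + h̄ dz̄` on a simply connected domain has a smooth
primitive. -/
theorem exists_primitive {Ω : Set ℂ} (hΩ : IsOpen Ω) (hsc : IsSimplyConnected Ω) {h : ℂ → ℂ}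
    (hh : ContDiffOn ℝ ∞ h Ω) (hreal : ∀ w ∈ Ω, conj (dzbar h w) = dzbar h w) (P : ℂ) (c : ℝ) :
    ∃ x : ℂ → ℝ, ContDiffOn ℝ ∞ x Ω ∧ x P = c ∧
      ∀ w ∈ Ω, HasWirtinger (fun u => (x u : ℂ)) (h w) (conj (h w)) w := by
  -- The charts are all local primitives; the additive group of ℝ, written multiplicatively, acts
  -- freely on the values by translation.
  let ι := {t : Set ℂ × (ℂ → ℝ) //
    IsOpen t.1 ∧ ∀ u ∈ t.1, HasFDerivAt t.2 (reForm (h u)) u}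
  obtain ⟨S, hS⟩ := hsc.exists_glue hΩ (G := Multiplicative ℝ) (fun i : ι => i.1.1)
    (fun i => i.2.1) (fun w hw => by
      obtain ⟨r, hr, hrΩ⟩ := Metric.isOpen_iff.mp hΩ w hw
      obtain ⟨F, hF⟩ := exists_primitive_ball (hh.mono hrΩ) fun u hu => hreal u (hrΩ hu)
      exact ⟨⟨(Metric.ball w r, F), Metric.isOpen_ball, hF⟩, Metric.mem_ball_self hr⟩)
    (fun i => i.1.2)
    (fun i w _ g hg => by
      have : g.toAdd + i.1.2 w = i.1.2 w := hg
      exact toAdd_eq_zero.mp (by linarith))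
    (fun i j w hw => ⟨.ofAdd (i.1.2 w - j.1.2 w), eventually_eq_add_of_hasFDerivAt
      ((i.2.1.inter j.2.1).mem_nhds hw) (fun u hu => i.2.2 u hu.1) (fun u hu => j.2.2 u hu.2)⟩)
  have hd : ∀ w ∈ Ω, HasFDerivAt (fun u => S u + (c - S P)) (reForm (h w)) w := fun w hw => by
    obtain ⟨i, hi, g, hg⟩ := hS w hw
    exact (((i.2.2 w hi).const_add g.toAdd).congr_of_eventuallyEq hg).add_const _
  refine ⟨fun u => S u + (c - S P), ?_, by ring, fun w hw =>
    hasWirtinger_of_hasFDerivAt_reForm (hd w hw)⟩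
  -- Gluing gives only differentiability; smoothness follows because the derivative `reForm ∘ h` is
  -- smooth.
  rw [contDiffOn_infty_iff_fderiv_of_isOpen hΩ]
  exact ⟨fun w hw => (hd w hw).differentiableAt.differentiableWithinAt,
    (reForm.contDiff.comp_contDiffOn hh).congr fun w hw => (hd w hw).fderiv⟩

/-! ### Lifting null curves to spinors -/

/-- Dividing by `p w` moves the value at w to 1, inside the slit plane where the principal logarithm
is smooth; a square root c of `p w` restores the scale. -/
theorem exists_local_sqrt {Ω : Set ℂ} (hΩ : IsOpen Ω) {p : ℂ → ℂ} (hp : ContDiffOn ℝ ∞ p Ω)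
    {w : ℂ} (hw : w ∈ Ω) (hpw : p w ≠ 0) :
    ∃ U : Set ℂ, IsOpen U ∧ w ∈ U ∧ U ⊆ Ω ∧ ∃ r : ℂ → ℂ, ContDiffOn ℝ ∞ r U ∧
      ∀ u ∈ U, r u ^ 2 = p u ∧ r u ≠ 0 := by
  obtain ⟨c, hc⟩ := IsAlgClosed.exists_pow_nat_eq (p w) two_pos
  have hdiv : ContDiffOn ℝ ∞ (fun u => p u / p w) Ω := hp.div_const _
  refine ⟨Ω ∩ (fun u => p u / p w) ⁻¹' slitPlane,
    hdiv.continuousOn.isOpen_inter_preimage hΩ isOpen_slitPlane,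
    ⟨hw, by simp [hpw]⟩, Set.inter_subset_left,
    fun u => c * exp (log (p u / p w) / 2), ?_, fun u hu => ⟨?_, ?_⟩⟩
  · intro u hu
    refine ContDiffWithinAt.mul contDiffWithinAt_const ?_
    refine ContDiffWithinAt.cexp (ContDiffWithinAt.div_const ?_ 2)
    exact ((contDiffAt_log hu.2).restrict_scalars ℝ).comp_contDiffWithinAt u
      ((hdiv u hu.1).mono Set.inter_subset_left)
  · rw [mul_pow, ← exp_nat_mul, hc]
    have h0 : p u / p w ≠ 0 := slitPlane_ne_zero hu.2
    rw [show ((2 : ℕ) : ℂ) * (log (p u / p w) / 2) = log (p u / p w) by push_cast; ring,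
      exp_log h0, mul_div_cancel₀ _ hpw]
  · have : c ≠ 0 := by rintro rfl; exact hpw (by simpa using hc.symm)
    exact mul_ne_zero this (exp_ne_zero _)

/-- The product couples the two signs; when a vanishes its sign is immaterial and only that of b
counts. -/
theorem eq_or_eq_neg_of_sq_eq {a b a' b' : ℂ} (ha : a ^ 2 = a' ^ 2) (hb : b ^ 2 = b' ^ 2)
    (hab : a * b = a' * b') : (a, b) = (a', b') ∨ (a, b) = -(a', b') := by
  by_cases h0 : a' = 0
  · have : a = 0 := by simpa [h0] using ha
    rcases sq_eq_sq_iff_eq_or_eq_neg.mp hb with h | h <;> simp [h0, this, h]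
  · rcases sq_eq_sq_iff_eq_or_eq_neg.mp ha with h | h
    · left
      rw [h] at hab
      rw [h, mul_left_cancel₀ h0 hab]
    · right
      rw [h] at hab
      have : b = -b' := mul_left_cancel₀ h0 (by linear_combination -hab)
      simp [h, this]

/-- Where s ≠ 0 the two alternatives exclude each other, and by continuity the one failing at w
keeps failing nearby. -/
theorem eventually_eq_smul_of_sq_eq {s t : ℂ → ℂ × ℂ} {w : ℂ} (hs : ContinuousAt s w)
    (ht : ContinuousAt t w) (h0 : s w ≠ 0) (h : ∀ᶠ u in 𝓝 w, s u = t u ∨ s u = -t u) :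
    ∃ g : ℤˣ, ∀ᶠ u in 𝓝 w, s u = g • t u := by
  rcases h.self_of_nhds with hw | hw
  · refine ⟨1, ?_⟩
    have : ∀ᶠ u in 𝓝 w, s u + t u ≠ 0 := (hs.add ht).eventually_ne (by
      rw [Pi.add_apply]
      rw [← hw, ← two_smul ℂ]
      exact smul_ne_zero two_ne_zero h0)
    filter_upwards [h, this] with u hu hu'
    rcases hu with hu | hu
    · simpa using hu
    · simp [hu] at hu'
  · refine ⟨-1, ?_⟩
    have : ∀ᶠ u in 𝓝 w, s u - t u ≠ 0 := (hs.sub ht).eventually_ne (by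
      rw [Pi.sub_apply]
      rw [show t w = -s w by rw [hw, neg_neg], sub_neg_eq_add, ← two_smul ℂ]
      exact smul_ne_zero two_ne_zero h0)
    filter_upwards [h, this] with u hu hu'
    rcases hu with hu | hu
    · simp [hu] at hu'
    · simpa [Units.smul_def] using hu

/-- On a simply connected domain, smooth functions with `p q = r²` and `(p, q) ≠ 0` are of the
form `p = a²`, `q = b²`, `r = a b`. -/
theorem exists_sqrt_pair {Ω : Set ℂ} (hΩ : IsOpen Ω) (hsc : IsSimplyConnected Ω) {p q r : ℂ → ℂ}
    (hp : ContDiffOn ℝ ∞ p Ω) (hq : ContDiffOn ℝ ∞ q Ω) (hr : ContDiffOn ℝ ∞ r Ω)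
    (hpq : ∀ w ∈ Ω, p w * q w = r w ^ 2) (h0 : ∀ w ∈ Ω, p w ≠ 0 ∨ q w ≠ 0) :
    ∃ a b : ℂ → ℂ, ContDiffOn ℝ ∞ a Ω ∧ ContDiffOn ℝ ∞ b Ω ∧
      ∀ w ∈ Ω, a w ^ 2 = p w ∧ b w ^ 2 = q w ∧ a w * b w = r w := by
  let ι := {t : Set ℂ × (ℂ → ℂ × ℂ) // IsOpen t.1 ∧ t.1 ⊆ Ω ∧ ContDiffOn ℝ ∞ t.2 t.1 ∧
    ∀ u ∈ t.1, (t.2 u).1 ^ 2 = p u ∧ (t.2 u).2 ^ 2 = q u ∧ (t.2 u).1 * (t.2 u).2 = r u}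
  have hne : ∀ i : ι, ∀ w ∈ i.1.1, i.1.2 w ≠ 0 := fun i w hw he => by
    obtain ⟨h1, h2, -⟩ := i.2.2.2.2 w hw
    rcases h0 w (i.2.2.1 hw) with h | h
    · exact h (by simpa [he] using h1.symm)
    · exact h (by simpa [he] using h2.symm)
  have hcont : ∀ i : ι, ∀ w ∈ i.1.1, ContinuousAt i.1.2 w := fun i w hw =>
    i.2.2.2.1.continuousOn.continuousAt (i.2.1.mem_nhds hw)
  obtain ⟨S, hS⟩ := hsc.exists_glue hΩ (G := ℤˣ) (fun i : ι => i.1.1)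
    (fun i => i.2.1) (fun w hw => by
      -- Where p ≠ 0 take a = √p and b = r/a; where q ≠ 0 take b = √q and a = r/b.
      rcases h0 w hw with h | h
      · obtain ⟨U, hU, hwU, hUΩ, s, hs, hs'⟩ := exists_local_sqrt hΩ hp hw h
        refine ⟨⟨(U, fun u => (s u, r u * (s u)⁻¹)), hU, hUΩ, hs.prodMk
          ((hr.mono hUΩ).mul (hs.inv fun u hu => (hs' u hu).2)), fun u hu => ?_⟩, hwU⟩
        obtain ⟨h1, h2⟩ := hs' u hu
        refine ⟨h1, ?_, by field_simp⟩
        have h3 := hpq u (hUΩ hu)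
        rw [← h1] at h3
        field_simp
        exact h3.symm
      · obtain ⟨U, hU, hwU, hUΩ, s, hs, hs'⟩ := exists_local_sqrt hΩ hq hw h
        refine ⟨⟨(U, fun u => (r u * (s u)⁻¹, s u)), hU, hUΩ,
          ((hr.mono hUΩ).mul (hs.inv fun u hu => (hs' u hu).2)).prodMk hs, fun u hu => ?_⟩, hwU⟩
        obtain ⟨h1, h2⟩ := hs' u hu
        refine ⟨?_, h1, by field_simp⟩
        have h3 := hpq u (hUΩ hu)
        rw [← h1] at h3
        field_simp
        linear_combination -h3)
    (fun i => i.1.2)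
    (fun i w hw g hg => by
      rcases Int.units_eq_one_or g with h | h
      · exact h
      · refine absurd (self_eq_neg.mp (?_ : i.1.2 w = -i.1.2 w)) (hne i w hw)
        rw [h] at hg
        simpa [Units.smul_def] using hg.symm)
    (fun i j w hw => eventually_eq_smul_of_sq_eq (hcont i w hw.1) (hcont j w hw.2)
      (hne i w hw.1) (by
        filter_upwards [(i.2.1.inter j.2.1).mem_nhds hw] with u hu
        obtain ⟨h1, h2, h3⟩ := i.2.2.2.2 u hu.1
        obtain ⟨h1', h2', h3'⟩ := j.2.2.2.2 u hu.2
        exact eq_or_eq_neg_of_sq_eq (h1.trans h1'.symm) (h2.trans h2'.symm) (h3.trans h3'.symm)))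
  have hC : ContDiffOn ℝ ∞ S Ω := fun w hw => by
    obtain ⟨i, hi, g, hg⟩ := hS w hw
    have h1 : ContDiffAt ℝ ∞ ((fun _ => ((g : ℤ) : ℝ)) • i.1.2) w :=
      contDiffAt_const.smul (i.2.2.2.1.contDiffAt (i.2.1.mem_nhds hi))
    refine (h1.congr_of_eventuallyEq (hg.mono fun u hu => ?_)).contDiffWithinAt
    rw [hu, Units.smul_def, Pi.smul_apply', Int.cast_smul_eq_zsmul]
  refine ⟨fun w => (S w).1, fun w => (S w).2, contDiff_fst.comp_contDiffOn hC,
    contDiff_snd.comp_contDiffOn hC, fun w hw => ?_⟩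
  obtain ⟨i, hi, g, hg⟩ := hS w hw
  simp only [hg.self_of_nhds]
  rcases Int.units_eq_one_or g with h | h <;>
    simpa [h, Units.smul_def] using i.2.2.2.2 w hi

end

section

/-! ### The left invariant frame along a map to Nil -/

theorem mat_eq_nilMatrix (g : Nil) : mat g = nilMatrix (mat g 0 1) (mat g 1 2) (mat g 0 2) := by
  obtain ⟨x, y, z, h⟩ := g.2
  change mat g = _ at h
  simp [h, nilMatrix]

theorem mat_inv (g : Nil) : mat g⁻¹ =
    nilMatrix (-mat g 0 1) (-mat g 1 2) (mat g 0 1 * mat g 1 2 - mat g 0 2) := by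
  have h : mat g⁻¹ = (mat g).adjugate := Matrix.SpecialLinearGroup.coe_inv _
  rw [h, mat_eq_nilMatrix g]
  simp [nilMatrix, Matrix.adjugate_fin_three]

variable {f : ℂ → Nil} {Ω : Set ℂ} {w : ℂ}

theorem leftVelocity_eq (f : ℂ → Nil) (w v : ℂ) : leftVelocity f w v =
    ![fderiv ℝ (fun u => mat (f u) 0 1) w v, fderiv ℝ (fun u => mat (f u) 1 2) w v,
      fderiv ℝ (fun u => mat (f u) 0 2) w v -
        mat (f w) 0 1 * fderiv ℝ (fun u => mat (f u) 1 2) w v] := by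
  have h1 : (fun u => mat (f u) 1 1) = fun _ => (1 : ℝ) := by
    funext u; rw [mat_eq_nilMatrix (f u)]; simp [nilMatrix]
  have h2 : (fun u => mat (f u) 2 1) = fun _ => (0 : ℝ) := by
    funext u; rw [mat_eq_nilMatrix (f u)]; simp [nilMatrix]
  have h3 : (fun u => mat (f u) 2 2) = fun _ => (1 : ℝ) := by
    funext u; rw [mat_eq_nilMatrix (f u)]; simp [nilMatrix]
  funext k
  fin_cases k <;>
    simp [leftVelocity, coord, mat_inv, nilMatrix, velocity, Matrix.mul_apply,
      Fin.sum_univ_three, h1, h2, h3]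
  ring

theorem dz_const (c w : ℂ) : dz (fun _ => c) w = 0 := (HasWirtinger.const c w).dz_eq

theorem Psi_eq (f : ℂ → Nil) (w : ℂ) : Psi f w =
    !![0, dz (fun u => (mat (f u) 0 1 : ℂ)) w, dz (fun u => (mat (f u) 0 2 : ℂ)) w -
        mat (f w) 0 1 * dz (fun u => (mat (f u) 1 2 : ℂ)) w;
      0, 0, dz (fun u => (mat (f u) 1 2 : ℂ)) w; 0, 0, 0] := by
  have h : ∀ i j c, (∀ u, mat (f u) i j = c) → dz (fun u => (mat (f u) i j : ℂ)) w = 0 :=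
    fun i j c h => by simp only [h, dz_const]
  have h00 := h 0 0 1 fun u => by rw [mat_eq_nilMatrix (f u)]; simp [nilMatrix]
  have h10 := h 1 0 0 fun u => by rw [mat_eq_nilMatrix (f u)]; simp [nilMatrix]
  have h11 := h 1 1 1 fun u => by rw [mat_eq_nilMatrix (f u)]; simp [nilMatrix]
  have h20 := h 2 0 0 fun u => by rw [mat_eq_nilMatrix (f u)]; simp [nilMatrix]
  have h21 := h 2 1 0 fun u => by rw [mat_eq_nilMatrix (f u)]; simp [nilMatrix]
  have h22 := h 2 2 1 fun u => by rw [mat_eq_nilMatrix (f u)]; simp [nilMatrix]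
  ext i j
  fin_cases i <;> fin_cases j <;>
    simp [Psi, mat_inv, nilMatrix, Matrix.mul_apply, Fin.sum_univ_three, h00, h10, h11, h20,
      h21, h22]
  ring

theorem sum_smul_e (c : Fin 3 → ℂ) : ∑ k, c k • (e k).map Complex.ofReal =
    !![0, c 0, c 2; 0, 0, c 1; 0, 0, 0] := by
  ext i j
  fin_cases i <;> fin_cases j <;> simp [e, Fin.sum_univ_three]

/-- `Psi` always lies in the complexified Lie algebra, so its three coordinates determine it. -/
theorem Psi_eq_sum_iff (f : ℂ → Nil) (w : ℂ) (c : Fin 3 → ℂ) :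
    Psi f w = ∑ k, c k • (e k).map Complex.ofReal ↔ coord (Psi f w) = c := by
  rw [sum_smul_e, Psi_eq]
  constructor
  · intro h
    rw [h]
    funext k
    fin_cases k <;> simp [coord]
  · rintro rfl
    ext i j
    fin_cases i <;> fin_cases j <;> simp [coord]

theorem IsSmooth.hasWirtinger (hf : IsSmooth f Ω) (hΩ : IsOpen Ω) (hw : w ∈ Ω) (i j : Fin 3) :
    HasWirtinger (fun u => (mat (f u) i j : ℂ)) (dz (fun u => (mat (f u) i j : ℂ)) w)
      (conj (dz (fun u => (mat (f u) i j : ℂ)) w)) w := by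
  have h := (hf i j).complex_ofReal.hasWirtinger hΩ hw
  refine h.congr_deriv rfl ?_
  have h' := h.conjugate
  simp only [conj_ofReal] at h'
  exact h'.dzbar_eq

theorem IsSmooth.fderiv_apply (hf : IsSmooth f Ω) (hΩ : IsOpen Ω) (hw : w ∈ Ω) (i j : Fin 3)
    (v : ℂ) : ((fderiv ℝ (fun u => mat (f u) i j) w v : ℝ) : ℂ) =
      dz (fun u => (mat (f u) i j : ℂ)) w * v +
        conj (dz (fun u => (mat (f u) i j : ℂ)) w) * conj v :=
  (hf.hasWirtinger hΩ hw i j).ofReal_fderiv_apply v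

theorem IsSmooth.leftVelocity_eq (hf : IsSmooth f Ω) (hΩ : IsOpen Ω) (hw : w ∈ Ω) (v : ℂ)
    (k : Fin 3) : (leftVelocity f w v k : ℂ) =
      coord (Psi f w) k * v + conj (coord (Psi f w) k) * conj v := by
  rw [NilSurface.leftVelocity_eq, Psi_eq]
  fin_cases k <;> simp [coord, hf.fderiv_apply hΩ hw]
  ring

theorem IsSmooth.contDiffOn_coord_Psi (hf : IsSmooth f Ω) (hΩ : IsOpen Ω) (k : Fin 3) :
    ContDiffOn ℝ ∞ (fun w => coord (Psi f w) k) Ω := by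
  have h : ∀ i j, ContDiffOn ℝ ∞ (dz fun u => (mat (f u) i j : ℂ)) Ω := fun i j =>
    (hf i j).complex_ofReal.dz hΩ
  have h2 := (h 0 2).sub ((hf 0 1).complex_ofReal.mul (h 1 2))
  simp only [Psi_eq]
  fin_cases k
  · exact h 0 1
  · exact h 1 2
  · exact h2

/-- ∂̄∂ of a real function is a quarter of its Laplacian. -/
theorem IsSmooth.dzbar_dz_real (hf : IsSmooth f Ω) (hΩ : IsOpen Ω) (hw : w ∈ Ω) (i j : Fin 3) :
    conj (dzbar (dz fun u => (mat (f u) i j : ℂ)) w) =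
      dzbar (dz fun u => (mat (f u) i j : ℂ)) w := by
  have hC := (hf i j).complex_ofReal
  have h1 := ((hC.dz hΩ).hasWirtinger hΩ hw).conjugate
  have h2 : dzbar (fun u => (mat (f u) i j : ℂ)) =ᶠ[𝓝 w]
      fun u => conj (dz (fun u => (mat (f u) i j : ℂ)) u) := by
    filter_upwards [hΩ.mem_nhds hw] with u hu
    exact (hf.hasWirtinger hΩ hu i j).dzbar_eq
  rw [← (h1.congr_of_eventuallyEq h2).dz_eq, dzbar_dz hC hΩ hw]

/-- The Maurer-Cartan equations. -/
theorem IsSmooth.maurerCartan (hf : IsSmooth f Ω) (hΩ : IsOpen Ω) (hw : w ∈ Ω) :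
    conj (dzbar (fun u => coord (Psi f u) 0) w) = dzbar (fun u => coord (Psi f u) 0) w ∧
    conj (dzbar (fun u => coord (Psi f u) 1) w) = dzbar (fun u => coord (Psi f u) 1) w ∧
    dzbar (fun u => coord (Psi f u) 2) w - conj (dzbar (fun u => coord (Psi f u) 2) w) =
      coord (Psi f w) 0 * conj (coord (Psi f w) 1) -
        conj (coord (Psi f w) 0) * coord (Psi f w) 1 := by
  have hx := hf.hasWirtinger hΩ hw 0 1
  have h12 := ((hf 1 2).complex_ofReal.dz hΩ).hasWirtinger hΩ hw
  have h02 := ((hf 0 2).complex_ofReal.dz hΩ).hasWirtinger hΩ hw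
  have e0 : (fun u => coord (Psi f u) 0) = dz fun u => (mat (f u) 0 1 : ℂ) := by
    funext u; simp [Psi_eq, coord]
  have e1 : (fun u => coord (Psi f u) 1) = dz fun u => (mat (f u) 1 2 : ℂ) := by
    funext u; simp [Psi_eq, coord]
  have e2 : (fun u => coord (Psi f u) 2) = fun u => dz (fun u => (mat (f u) 0 2 : ℂ)) u -
      mat (f u) 0 1 * dz (fun u => (mat (f u) 1 2 : ℂ)) u := by
    funext u; simp [Psi_eq, coord]
  have e0' := congrFun e0 w
  have e1' := congrFun e1 w
  refine ⟨e0 ▸ hf.dzbar_dz_real hΩ hw 0 1, e1 ▸ hf.dzbar_dz_real hΩ hw 1 2, ?_⟩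
  -- The second derivatives of the entries are real and cancel against their conjugates; what
  -- survives comes from differentiating the factor x in z_z - x y_z.
  rw [e2, (h02.sub (hx.mul h12)).dzbar_eq, e0', e1']
  simp only [map_sub, map_add, map_mul, conj_ofReal, conj_conj, hf.dzbar_dz_real hΩ hw]
  ring

/-! ### Spinors of conformal maps -/

/-- A linear change of coordinates turns the spinor parametrisation of the null cone into (a², b²,
ab). -/
theorem spinorZ_eq_iff (a b : ℂ) (c : Fin 3 → ℂ) : spinorZ a (conj b) = c ↔
    a ^ 2 = -I * c 0 - c 1 ∧ b ^ 2 = -I * c 0 + c 1 ∧ a * b = c 2 := by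
  constructor
  · rintro rfl
    refine ⟨?_, ?_, ?_⟩ <;> simp [spinorZ]
    · linear_combination (1 / 2 * (b ^ 2 + a ^ 2)) * I_mul_I
    · linear_combination (1 / 2 * (b ^ 2 + a ^ 2)) * I_mul_I
  · rintro ⟨h1, h2, h3⟩
    funext k
    fin_cases k <;> simp [spinorZ]
    · linear_combination I / 2 * (h1 + h2) - c 0 * I_mul_I
    · linear_combination 1 / 2 * (h2 - h1)
    · exact h3

theorem IsSurface.exists_spinor (hf : IsSurface f Ω) (hΩ : IsOpen Ω) (hsc : IsSimplyConnected Ω) :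
    ∃ ψ₁ ψ₂ : ℂ → ℂ, IsGeneratingSpinor f Ω ψ₁ ψ₂ := by
  obtain ⟨hs, hc⟩ := hf
  have hC := hs.contDiffOn_coord_Psi hΩ
  -- The identity used is 4 ∑ Z_k² = |f_x|² - |f_y|² - 2i⟨f_x, f_y⟩.
  have hE : ∀ w ∈ Ω, coord (Psi f w) 0 ^ 2 + coord (Psi f w) 1 ^ 2 + coord (Psi f w) 2 ^ 2 = 0 ∧
      ¬(coord (Psi f w) 0 = 0 ∧ coord (Psi f w) 1 = 0 ∧ coord (Psi f w) 2 = 0) := by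
    intro w hw
    obtain ⟨h1, h2, h3⟩ := hc w hw
    change 0 < leftVelocity f w 1 ⬝ᵥ leftVelocity f w 1 at h1
    change leftVelocity f w 1 ⬝ᵥ leftVelocity f w 1 = leftVelocity f w I ⬝ᵥ leftVelocity f w I at h2
    change leftVelocity f w 1 ⬝ᵥ leftVelocity f w I = 0 at h3
    have hL := hs.leftVelocity_eq hΩ hw
    simp only [dotProduct, Fin.sum_univ_three] at h1 h2 h3
    have h2' := congrArg Complex.ofReal h2
    have h3' := congrArg Complex.ofReal h3
    push_cast at h2' h3'
    simp only [hL, map_one, conj_I, mul_one] at h2' h3'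
    generalize coord (Psi f w) = c at *
    constructor
    · linear_combination h2' / 4 - I / 2 * h3' + (1 / 4 * ((c 0 - conj (c 0)) ^ 2 +
        (c 1 - conj (c 1)) ^ 2 + (c 2 - conj (c 2)) ^ 2) +
        1 / 2 * (c 0 ^ 2 - conj (c 0) ^ 2 + c 1 ^ 2 - conj (c 1) ^ 2 +
          c 2 ^ 2 - conj (c 2) ^ 2)) * I_mul_I
    · rintro ⟨z0, z1, z2⟩
      have : ∀ k, leftVelocity f w 1 k = 0 := fun k => by
        rw [← ofReal_eq_zero, hL]
        fin_cases k <;> simp [z0, z1, z2]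
      simp [this] at h1
  obtain ⟨a, b, ha, hb, hab⟩ := exists_sqrt_pair hΩ hsc
    (p := fun w => -I * coord (Psi f w) 0 - coord (Psi f w) 1)
    (q := fun w => -I * coord (Psi f w) 0 + coord (Psi f w) 1)
    (r := fun w => coord (Psi f w) 2)
    ((contDiffOn_const.mul (hC 0)).sub (hC 1)) ((contDiffOn_const.mul (hC 0)).add (hC 1)) (hC 2)
    (fun w hw => by
      linear_combination -(hE w hw).1 + coord (Psi f w) 0 ^ 2 * I_mul_I)
    (fun w hw => by
      by_contra! h
      obtain ⟨h1, h2⟩ := h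
      refine (hE w hw).2 ?_
      have z1 : coord (Psi f w) 1 = 0 := by linear_combination (h2 - h1) / 2
      have z0 : coord (Psi f w) 0 = 0 := by
        linear_combination I / 2 * (h1 + h2) + coord (Psi f w) 0 * I_mul_I
      exact ⟨z0, z1, by simpa [z0, z1] using (hE w hw).1⟩)
  exact ⟨a, fun w => conj (b w), ha, hb.conjugate, fun w hw =>
    (Psi_eq_sum_iff _ _ _).mpr ((spinorZ_eq_iff _ _ _).mpr (hab w hw)).symm⟩

end

section

/-! ### The fundamental forms of a surface in terms of its generating spinor -/

theorem structureConst_eq : structureConst =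
    ![![![0, 0, 0], ![0, 0, 1], ![0, 0, 0]], ![![0, 0, -1], ![0, 0, 0], ![0, 0, 0]],
      ![![0, 0, 0], ![0, 0, 0], ![0, 0, 0]]] := by
  funext i j k
  fin_cases i <;> fin_cases j <;> fin_cases k <;>
    simp [structureConst, e, coord, Ring.lie_def]

theorem leviCivita_eq : leviCivita =
    ![![![0, 0, 0], ![0, 0, 1 / 2], ![0, -1 / 2, 0]],
      ![![0, 0, -1 / 2], ![0, 0, 0], ![1 / 2, 0, 0]],
      ![![0, -1 / 2, 0], ![1 / 2, 0, 0], ![0, 0, 0]]] := by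
  funext k j i
  fin_cases i <;> fin_cases j <;> fin_cases k <;>
    norm_num [leviCivita, structureConst_eq]

theorem ofReal_norm_sq (c : ℂ) : (‖c‖ : ℂ) ^ 2 = c * conj c := (mul_conj' c).symm

/-- The unit normal times the conformal factor, for the spinor `(a, b)`. -/
def spinorNormal (a b : ℂ) : Fin 3 → ℝ :=
  ![-2 * (a * b).im, -2 * (a * b).re, ‖b‖ ^ 2 - ‖a‖ ^ 2]

theorem ofReal_spinorNormal (a b : ℂ) (k : Fin 3) : (spinorNormal a b k : ℂ) =
    ![I * (a * b - conj a * conj b), -(a * b + conj a * conj b),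
      b * conj b - a * conj a] k := by
  fin_cases k
  · simp only [spinorNormal, Fin.zero_eta, Matrix.cons_val_zero, ofReal_mul, ofReal_neg,
      ofReal_ofNat, im_eq_sub_conj, map_mul]
    field_simp
    linear_combination (-(a * b - conj a * conj b)) * I_sq
  · simp only [spinorNormal, Fin.mk_one, Matrix.cons_val_one, Matrix.cons_val_zero, ofReal_mul,
      ofReal_neg, ofReal_ofNat, re_eq_add_conj, map_mul]
    ring
  · simp [spinorNormal, ofReal_norm_sq]

variable {f : ℂ → Nil} {Ω : Set ℂ} {ψ₁ ψ₂ : ℂ → ℂ} {w : ℂ}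

namespace IsGeneratingSpinor

theorem coord_Psi (h : IsGeneratingSpinor f Ω ψ₁ ψ₂) (hw : w ∈ Ω) :
    coord (Psi f w) = spinorZ (ψ₁ w) (ψ₂ w) :=
  (Psi_eq_sum_iff _ _ _).mp (h.2.2 w hw)

theorem leftVelocity_eq (h : IsGeneratingSpinor f Ω ψ₁ ψ₂) (hf : IsSmooth f Ω) (hΩ : IsOpen Ω)
    (hw : w ∈ Ω) (v : ℂ) (k : Fin 3) : (leftVelocity f w v k : ℂ) =
      spinorZ (ψ₁ w) (ψ₂ w) k * v + conj (spinorZ (ψ₁ w) (ψ₂ w) k) * conj v := by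
  rw [hf.leftVelocity_eq hΩ hw, h.coord_Psi hw]

/-- The induced metric is `(|ψ₁|² + |ψ₂|²)² dz dz̄`. -/
theorem nilMetric_eq (h : IsGeneratingSpinor f Ω ψ₁ ψ₂) (hf : IsSmooth f Ω) (hΩ : IsOpen Ω)
    (hw : w ∈ Ω) :
    nilMetric (f w) (velocity f w 1) (velocity f w 1) = (‖ψ₁ w‖ ^ 2 + ‖ψ₂ w‖ ^ 2) ^ 2 ∧
    nilMetric (f w) (velocity f w I) (velocity f w I) = (‖ψ₁ w‖ ^ 2 + ‖ψ₂ w‖ ^ 2) ^ 2 ∧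
    nilMetric (f w) (velocity f w 1) (velocity f w I) = 0 := by
  have hL := h.leftVelocity_eq hf hΩ hw
  change leftVelocity f w 1 ⬝ᵥ leftVelocity f w 1 = _ ∧
    leftVelocity f w I ⬝ᵥ leftVelocity f w I = _ ∧ leftVelocity f w 1 ⬝ᵥ leftVelocity f w I = _
  refine ⟨?_, ?_, ?_⟩ <;> apply ofReal_injective <;>
    simp only [dotProduct, Fin.sum_univ_three, ofReal_add, ofReal_mul, hL, ofReal_pow,
      ofReal_norm_sq, map_one, conj_I, mul_one, ofReal_zero] <;>
    simp only [spinorZ, star_def, Matrix.cons_val_zero, Matrix.cons_val_one, Matrix.cons_val,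
      map_mul, map_add, map_sub, map_div₀, map_pow, conj_conj, conj_I, map_ofNat, map_one] <;>
    generalize conj (ψ₁ w) = a' <;> generalize conj (ψ₂ w) = b' <;>
    generalize ψ₁ w = a <;> generalize ψ₂ w = b <;> ring_nf <;>
    simp only [I_sq, I_pow_three, I_pow_four] <;> ring

/-- The cross product f_x × f_y is e^α times `spinorNormal`, which itself has length e^α because
4|ab|² + (|b|² - |a|²)² = (|a|² + |b|²)². -/
theorem normal_eq (h : IsGeneratingSpinor f Ω ψ₁ ψ₂) (hf : IsSmooth f Ω) (hΩ : IsOpen Ω)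
    (hw : w ∈ Ω) (h0 : ‖ψ₁ w‖ ^ 2 + ‖ψ₂ w‖ ^ 2 ≠ 0) :
    normal f w = (‖ψ₁ w‖ ^ 2 + ‖ψ₂ w‖ ^ 2)⁻¹ • spinorNormal (ψ₁ w) (ψ₂ w) := by
  have hL := h.leftVelocity_eq hf hΩ hw
  have hn : crossProduct (leftVelocity f w 1) (leftVelocity f w I) =
      (‖ψ₁ w‖ ^ 2 + ‖ψ₂ w‖ ^ 2) • spinorNormal (ψ₁ w) (ψ₂ w) := by
    funext k
    apply ofReal_injective
    rw [Pi.smul_apply, smul_eq_mul, ofReal_mul, ofReal_spinorNormal, cross_apply]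
    fin_cases k <;>
      simp only [Fin.zero_eta, Fin.mk_one, Fin.reduceFinMk, ofReal_add, ofReal_mul, ofReal_sub, hL,
        ofReal_pow, ofReal_norm_sq, map_one, conj_I, mul_one, spinorZ, star_def,
        Matrix.cons_val_zero, Matrix.cons_val_one, Matrix.cons_val, map_mul, map_add, map_sub,
        map_div₀, map_pow, conj_conj, map_ofNat] <;>
      generalize conj (ψ₁ w) = a' <;> generalize conj (ψ₂ w) = b' <;>
      generalize ψ₁ w = a <;> generalize ψ₂ w = b <;> ring_nf <;>
      simp only [I_sq] <;> ring
  have hM : spinorNormal (ψ₁ w) (ψ₂ w) ⬝ᵥ spinorNormal (ψ₁ w) (ψ₂ w) =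
      (‖ψ₁ w‖ ^ 2 + ‖ψ₂ w‖ ^ 2) ^ 2 := by
    apply ofReal_injective
    simp only [dotProduct, Fin.sum_univ_three, ofReal_add, ofReal_mul, ofReal_spinorNormal,
      ofReal_pow, ofReal_norm_sq, Matrix.cons_val_zero, Matrix.cons_val_one, Matrix.cons_val]
    linear_combination (ψ₁ w * ψ₂ w - conj (ψ₁ w) * conj (ψ₂ w)) ^ 2 * I_sq
  rw [normal, hn]
  simp only [smul_dotProduct, dotProduct_smul, hM, smul_eq_mul, smul_smul]
  rw [show (‖ψ₁ w‖ ^ 2 + ‖ψ₂ w‖ ^ 2) * ((‖ψ₁ w‖ ^ 2 + ‖ψ₂ w‖ ^ 2) *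
    (‖ψ₁ w‖ ^ 2 + ‖ψ₂ w‖ ^ 2) ^ 2) = ((‖ψ₁ w‖ ^ 2 + ‖ψ₂ w‖ ^ 2) ^ 2) ^ 2 by ring,
    Real.sqrt_sq (by positivity)]
  congr 1
  field_simp

theorem hasWirtinger_coord_Psi (h : IsGeneratingSpinor f Ω ψ₁ ψ₂) (hΩ : IsOpen Ω) (hw : w ∈ Ω)
    (k : Fin 3) : HasWirtinger (fun u => coord (Psi f u) k)
      (![I * (conj (ψ₂ w) * conj (dzbar ψ₂ w) + ψ₁ w * dz ψ₁ w),
        conj (ψ₂ w) * conj (dzbar ψ₂ w) - ψ₁ w * dz ψ₁ w,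
        dz ψ₁ w * conj (ψ₂ w) + ψ₁ w * conj (dzbar ψ₂ w)] k)
      (![I * (conj (ψ₂ w) * conj (dz ψ₂ w) + ψ₁ w * dzbar ψ₁ w),
        conj (ψ₂ w) * conj (dz ψ₂ w) - ψ₁ w * dzbar ψ₁ w,
        dzbar ψ₁ w * conj (ψ₂ w) + ψ₁ w * conj (dz ψ₂ w)] k) w := by
  have h1 := h.1.hasWirtinger hΩ hw
  have h2 := (h.2.1.hasWirtinger hΩ hw).conjugate
  have he : (fun u => coord (Psi f u) k) =ᶠ[𝓝 w] fun u => spinorZ (ψ₁ u) (ψ₂ u) k := by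
    filter_upwards [hΩ.mem_nhds hw] with u hu
    rw [h.coord_Psi hu]
  refine HasWirtinger.congr_of_eventuallyEq ?_ he
  fin_cases k
  · exact ((h2.sq.add h1.sq).const_mul (I / 2)).congr_deriv (by simp; ring) (by simp; ring)
  · exact ((h2.sq.sub h1.sq).const_mul (1 / 2)).congr_deriv (by simp; ring) (by simp; ring)
  · exact (h1.mul h2).congr_deriv (by simp; ring) (by simp; ring)

/-- The ordinary derivatives of Z contribute the first two terms, the Levi-Civita coefficients the
term iψ₁²ψ̄₂². -/
theorem hopf_eq (h : IsGeneratingSpinor f Ω ψ₁ ψ₂) (hf : IsSmooth f Ω) (hΩ : IsOpen Ω)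
    (hw : w ∈ Ω) (h0 : ‖ψ₁ w‖ ^ 2 + ‖ψ₂ w‖ ^ 2 ≠ 0) :
    hopf f w = conj (ψ₂ w) * dz ψ₁ w - ψ₁ w * conj (dzbar ψ₂ w) +
      I * ψ₁ w ^ 2 * conj (ψ₂ w) ^ 2 := by
  have h0' : ((‖ψ₁ w‖ ^ 2 + ‖ψ₂ w‖ ^ 2 : ℝ) : ℂ) ≠ 0 := ofReal_ne_zero.mpr h0
  have hd := fun k => (h.hasWirtinger_coord_Psi hΩ hw k).dz_eq
  apply mul_left_cancel₀ h0'
  rw [hopf, Finset.mul_sum]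
  simp only [normal_eq h hf hΩ hw h0, Pi.smul_apply, smul_eq_mul, ofReal_mul, ofReal_inv]
  have hc : ∀ x y : ℂ, ((‖ψ₁ w‖ ^ 2 + ‖ψ₂ w‖ ^ 2 : ℝ) : ℂ) *
      (x * (((‖ψ₁ w‖ ^ 2 + ‖ψ₂ w‖ ^ 2 : ℝ) : ℂ)⁻¹ * y)) = x * y := fun x y => by field_simp
  simp only [hc, ofReal_spinorNormal]
  simp only [hd, h.coord_Psi hw, Fin.sum_univ_three, leviCivita_eq, spinorZ, star_def,
    Matrix.cons_val_zero, Matrix.cons_val_one, Matrix.cons_val, ofReal_add, ofReal_pow,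
    ofReal_norm_sq, ofReal_zero, ofReal_div, ofReal_neg, ofReal_one, ofReal_ofNat]
  generalize conj (ψ₁ w) = a'
  generalize conj (ψ₂ w) = b'
  generalize ψ₁ w = a
  generalize ψ₂ w = b
  ring_nf
  simp only [I_sq]
  ring

/-- The connection leaves no undifferentiated terms in the trace: ∇_{e_k} e_k = 0 for each k, and
⟨∇_v v, v⟩ = 0 for left invariant v, applied to the normal direction. -/
theorem meanCurvature_mul (h : IsGeneratingSpinor f Ω ψ₁ ψ₂) (hf : IsSmooth f Ω) (hΩ : IsOpen Ω)
    (hw : w ∈ Ω) (h0 : ‖ψ₁ w‖ ^ 2 + ‖ψ₂ w‖ ^ 2 ≠ 0) :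
    (meanCurvature f w : ℂ) * ((‖ψ₁ w‖ ^ 2 + ‖ψ₂ w‖ ^ 2 : ℝ) : ℂ) ^ 2 =
      conj (ψ₂ w) * dzbar ψ₁ w - conj (ψ₁ w) * dz ψ₂ w +
        (ψ₂ w * conj (dzbar ψ₁ w) - ψ₁ w * conj (dz ψ₂ w)) := by
  obtain ⟨hE, hG, hF⟩ := h.nilMetric_eq hf hΩ hw
  have h0' : ((‖ψ₁ w‖ ^ 2 + ‖ψ₂ w‖ ^ 2 : ℝ) : ℂ) ≠ 0 := ofReal_ne_zero.mpr h0
  have hd : ∀ u v k, ((fderiv ℝ (fun p => leftVelocity f p u k) w v : ℝ) : ℂ) = _ := fun u v k =>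
    HasWirtinger.ofReal_fderiv_apply (HasWirtinger.congr_of_eventuallyEq
      (((h.hasWirtinger_coord_Psi hΩ hw k).mul (.const u w)).add
        ((h.hasWirtinger_coord_Psi hΩ hw k).conjugate.mul (.const (conj u) w)))
      (by filter_upwards [hΩ.mem_nhds hw] with p hp using hf.leftVelocity_eq hΩ hp u k)) v
  have hH : meanCurvature f w * (‖ψ₁ w‖ ^ 2 + ‖ψ₂ w‖ ^ 2) ^ 2 =
      (secondForm f w 1 1 + secondForm f w I I) / 2 := by
    simp only [meanCurvature, hE, hF, hG]
    field_simp
    ring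
  have hS : ∀ u v, ((‖ψ₁ w‖ ^ 2 + ‖ψ₂ w‖ ^ 2 : ℝ) : ℂ) * (secondForm f w v u : ℂ) =
      ∑ i, (covDeriv f (fun p => leftVelocity f p u) w v i : ℂ) *
        (spinorNormal (ψ₁ w) (ψ₂ w) i : ℂ) := fun u v => by
    rw [secondForm, normal_eq h hf hΩ hw h0, dotProduct_smul, smul_eq_mul, ofReal_mul,
      ofReal_inv, mul_inv_cancel_left₀ h0', dotProduct, ofReal_sum]
    simp only [ofReal_mul]
  rw [← ofReal_pow, ← ofReal_mul, hH]
  apply mul_left_cancel₀ h0'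
  rw [ofReal_div, ofReal_add (secondForm f w 1 1), mul_div_assoc',
    mul_add _ (secondForm f w 1 1 : ℂ), hS, hS]
  simp only [covDeriv, ofReal_add, ofReal_sum, ofReal_mul, hd, h.leftVelocity_eq hf hΩ hw,
    ofReal_spinorNormal, h.coord_Psi hw]
  simp only [Fin.sum_univ_three, leviCivita_eq, spinorZ, star_def,
    Matrix.cons_val_zero, Matrix.cons_val_one, Matrix.cons_val, ofReal_pow,
    ofReal_norm_sq, ofReal_zero, ofReal_div, ofReal_neg, ofReal_one, ofReal_ofNat, map_one, conj_I,
    map_mul, map_add, map_sub, map_div₀, map_pow, conj_conj, map_ofNat, mul_zero, zero_add,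
    mul_one, add_zero]
  generalize conj (ψ₁ w) = a'
  generalize conj (ψ₂ w) = b'
  generalize ψ₁ w = a
  generalize ψ₂ w = b
  ring_nf
  simp only [I_sq, I_pow_three, I_pow_four]
  ring

end IsGeneratingSpinor

end

section

/-! ### Solutions of the Dirac equation -/

theorem ofReal_norm_sq_add (a b : ℂ) :
    ((‖a‖ ^ 2 + ‖b‖ ^ 2 : ℝ) : ℂ) = a * conj a + b * conj b := by
  rw [ofReal_add, ofReal_pow, ofReal_pow, ofReal_norm_sq, ofReal_norm_sq]

theorem nilPotential_eq (H : ℂ → ℝ) (a b : ℂ → ℂ) (w : ℂ) : nilPotential H a b w =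
    H w / 2 * (a w * conj (a w) + b w * conj (b w)) +
      I / 4 * (b w * conj (b w) - a w * conj (a w)) := by
  simp only [nilPotential, ofReal_norm_sq]

theorem nilDirac_iff (H : ℂ → ℝ) (a b : ℂ → ℂ) (w : ℂ) : NilDirac H a b w ↔
    dz b w = -nilPotential H a b w * a w ∧ dzbar a w = nilPotential H a b w * b w := by
  have h : NilDirac H a b w ↔ dz b w + nilPotential H a b w * a w = 0 ∧
      -dzbar a w + nilPotential H a b w * b w = 0 := by
    constructor
    · intro h
      exact ⟨congrFun h 0, congrFun h 1⟩
    · rintro ⟨h1, h2⟩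
      funext k
      fin_cases k
      · exact h1
      · exact h2
  rw [h]
  constructor <;> rintro ⟨h1, h2⟩
  · exact ⟨by linear_combination h1, by linear_combination -h2⟩
  · exact ⟨by linear_combination h1, by linear_combination -h2⟩

/-- A nowhere vanishing solution of the Dirac equation for Nil with smooth `H`. -/
structure IsDiracSpinor (H : ℂ → ℝ) (Ω : Set ℂ) (a b : ℂ → ℂ) : Prop where
  isOpen : IsOpen Ω
  smooth_fst : ContDiffOn ℝ ∞ a Ω
  smooth_snd : ContDiffOn ℝ ∞ b Ω
  smooth_H : ContDiffOn ℝ ∞ (fun u => (H u : ℂ)) Ω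
  dirac : ∀ w ∈ Ω, NilDirac H a b w
  ne_zero : ∀ w ∈ Ω, ‖a w‖ ^ 2 + ‖b w‖ ^ 2 ≠ 0

/-- The product of `∂α` and the conformal factor, for a solution `(a, b)` of the Dirac equation. -/
def spinorT (a b : ℂ → ℂ) (w : ℂ) : ℂ :=
  conj (a w) * dz a w + b w * conj (dzbar b w) -
    I / 2 * (b w * conj (b w) - a w * conj (a w)) * (a w * conj (b w))

namespace IsDiracSpinor

variable {H : ℂ → ℝ} {Ω : Set ℂ} {a b : ℂ → ℂ} {w : ℂ}

theorem ne_zero' (h : IsDiracSpinor H Ω a b) (hw : w ∈ Ω) :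
    a w * conj (a w) + b w * conj (b w) ≠ 0 := by
  rw [← ofReal_norm_sq_add]
  exact ofReal_ne_zero.mpr (h.ne_zero w hw)

theorem conj_potential (H : ℂ → ℝ) (a b : ℂ → ℂ) (w : ℂ) : conj (nilPotential H a b w) =
    H w / 2 * (a w * conj (a w) + b w * conj (b w)) -
      I / 4 * (b w * conj (b w) - a w * conj (a w)) := by
  simp only [nilPotential_eq, map_add, map_mul, map_sub, map_div₀, conj_ofReal, conj_conj, conj_I,
    map_ofNat]
  ring

theorem hasWirtinger_H (h : IsDiracSpinor H Ω a b) (hw : w ∈ Ω) :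
    HasWirtinger (fun u => (H u : ℂ)) (dz (fun u => (H u : ℂ)) w)
      (conj (dz (fun u => (H u : ℂ)) w)) w := by
  have h1 := h.smooth_H.hasWirtinger h.isOpen hw
  have h2 := h1.conjugate
  simp only [conj_ofReal] at h2
  exact h1.congr_deriv rfl h2.dzbar_eq

theorem hasWirtinger_fst (h : IsDiracSpinor H Ω a b) (hw : w ∈ Ω) :
    HasWirtinger a (dz a w) (nilPotential H a b w * b w) w :=
  (h.smooth_fst.hasWirtinger h.isOpen hw).congr_deriv rfl
    ((nilDirac_iff _ _ _ _).mp (h.dirac w hw)).2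

theorem hasWirtinger_snd (h : IsDiracSpinor H Ω a b) (hw : w ∈ Ω) :
    HasWirtinger b (-nilPotential H a b w * a w) (dzbar b w) w :=
  (h.smooth_snd.hasWirtinger h.isOpen hw).congr_deriv
    ((nilDirac_iff _ _ _ _).mp (h.dirac w hw)).1 rfl

/-- Two of the four terms of ∂(|a|² + |b|²) are given by the Dirac equation and add up to a b̄ (Ū -
U), the last summand of `spinorT`. -/
theorem hasWirtinger_factor (h : IsDiracSpinor H Ω a b) (hw : w ∈ Ω) :
    HasWirtinger (fun u => a u * conj (a u) + b u * conj (b u)) (spinorT a b w)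
      (conj (spinorT a b w)) w := by
  have ha := h.hasWirtinger_fst hw
  have hb := h.hasWirtinger_snd hw
  refine ((ha.mul ha.conjugate).add (hb.mul hb.conjugate)).congr_deriv ?_ ?_ <;>
  · simp only [spinorT, map_mul, map_neg, conj_potential, map_add, map_sub, map_div₀, conj_conj,
      conj_I, map_ofNat]
    rw [nilPotential_eq]
    ring

theorem hasWirtinger_log (h : IsDiracSpinor H Ω a b) {α : ℂ → ℝ}
    (hα : ∀ w ∈ Ω, α w = Real.log (‖a w‖ ^ 2 + ‖b w‖ ^ 2)) (hw : w ∈ Ω) :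
    HasWirtinger (fun u => (α u : ℂ))
      (spinorT a b w / (a w * conj (a w) + b w * conj (b w)))
      (conj (spinorT a b w) / (a w * conj (a w) + b w * conj (b w))) w := by
  have h1 := h.hasWirtinger_factor hw
  simp only [← ofReal_norm_sq_add] at h1
  have h2 := h1.ofReal_log (h.ne_zero w hw)
  rw [ofReal_norm_sq_add] at h2
  refine h2.congr_of_eventuallyEq ?_
  filter_upwards [h.isOpen.mem_nhds hw] with u hu
  rw [hα u hu]

/-- The Wirtinger derivatives of `|b|² - |a|²`, where the first one is abbreviated. -/
theorem hasWirtinger_difference (h : IsDiracSpinor H Ω a b) (hw : w ∈ Ω) :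
    HasWirtinger (fun u => b u * conj (b u) - a u * conj (a u))
      (b w * conj (dzbar b w) - nilPotential H a b w * a w * conj (b w) -
        (dz a w * conj (a w) + a w * conj (nilPotential H a b w) * conj (b w)))
      (conj (b w * conj (dzbar b w) - nilPotential H a b w * a w * conj (b w) -
        (dz a w * conj (a w) + a w * conj (nilPotential H a b w) * conj (b w)))) w := by
  have ha := h.hasWirtinger_fst hw
  have hb := h.hasWirtinger_snd hw
  refine ((hb.mul hb.conjugate).sub (ha.mul ha.conjugate)).congr_deriv ?_ ?_ <;>
  · simp only [map_mul, map_neg, map_add, map_sub, conj_conj]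
    ring

theorem hasWirtinger_potential (h : IsDiracSpinor H Ω a b) (hw : w ∈ Ω) :
    HasWirtinger (nilPotential H a b)
      (dz (fun u => (H u : ℂ)) w / 2 * (a w * conj (a w) + b w * conj (b w)) +
        H w / 2 * spinorT a b w + I / 4 *
        (b w * conj (dzbar b w) - nilPotential H a b w * a w * conj (b w) -
          (dz a w * conj (a w) + a w * conj (nilPotential H a b w) * conj (b w))))
      (conj (dz (fun u => (H u : ℂ)) w / 2 * (a w * conj (a w) + b w * conj (b w)) +
        H w / 2 * spinorT a b w - I / 4 *
        (b w * conj (dzbar b w) - nilPotential H a b w * a w * conj (b w) -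
          (dz a w * conj (a w) + a w * conj (nilPotential H a b w) * conj (b w))))) w := by
  have h1 := (((h.hasWirtinger_H hw).const_mul (1 / 2)).mul (h.hasWirtinger_factor hw)).add
    ((h.hasWirtinger_difference hw).const_mul (I / 4))
  refine (h1.congr_of_eventuallyEq (Eventually.of_forall fun u => ?_)).congr_deriv ?_ ?_
  · simp only [nilPotential_eq]
    ring
  · ring
  · simp only [map_add, map_sub, map_mul, map_div₀, conj_ofReal, conj_conj, conj_I, map_ofNat]
    ring

/-- This is ∂̄∂a = ∂(Ub). Together with its counterpart for b it removes all second derivatives from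
the Gauss and Codazzi equations. -/
theorem dzbar_dz_fst (h : IsDiracSpinor H Ω a b) (hw : w ∈ Ω) : dzbar (dz a) w =
    (dz (fun u => (H u : ℂ)) w / 2 * (a w * conj (a w) + b w * conj (b w)) +
      H w / 2 * spinorT a b w + I / 4 *
      (b w * conj (dzbar b w) - nilPotential H a b w * a w * conj (b w) -
        (dz a w * conj (a w) + a w * conj (nilPotential H a b w) * conj (b w)))) * b w -
      nilPotential H a b w ^ 2 * a w := by
  rw [dzbar_dz h.smooth_fst h.isOpen hw]
  have he : dzbar a =ᶠ[𝓝 w] fun u => nilPotential H a b u * b u := by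
    filter_upwards [h.isOpen.mem_nhds hw] with u hu using (h.hasWirtinger_fst hu).dzbar_eq
  rw [(((h.hasWirtinger_potential hw).mul
    (h.hasWirtinger_snd hw)).congr_of_eventuallyEq he).dz_eq]
  ring

theorem conj_dz_dzbar_snd (h : IsDiracSpinor H Ω a b) (hw : w ∈ Ω) :
    conj (dz (dzbar b) w) =
    -(dz (fun u => (H u : ℂ)) w / 2 * (a w * conj (a w) + b w * conj (b w)) +
      H w / 2 * spinorT a b w - I / 4 *
      (b w * conj (dzbar b w) - nilPotential H a b w * a w * conj (b w) -
        (dz a w * conj (a w) + a w * conj (nilPotential H a b w) * conj (b w)))) * conj (a w) -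
      conj (nilPotential H a b w) ^ 2 * conj (b w) := by
  rw [← dzbar_dz h.smooth_snd h.isOpen hw]
  have he : dz b =ᶠ[𝓝 w] fun u => (-1) * (nilPotential H a b u * a u) := by
    filter_upwards [h.isOpen.mem_nhds hw] with u hu
    rw [(h.hasWirtinger_snd hu).dz_eq]
    ring
  rw [((((h.hasWirtinger_potential hw).mul
    (h.hasWirtinger_fst hw)).const_mul (-1)).congr_of_eventuallyEq he).dzbar_eq]
  rw [map_mul, map_add (starRingEnd ℂ) (_ * _), map_mul, map_mul (starRingEnd ℂ) _ (a w),
    map_mul (starRingEnd ℂ) _ (b w), conj_conj, map_neg, map_one]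
  ring

theorem hasWirtinger_dz_fst (h : IsDiracSpinor H Ω a b) (hw : w ∈ Ω) :
    HasWirtinger (dz a) (dz (dz a) w) (dzbar (dz a) w) w :=
  (h.smooth_fst.dz h.isOpen).hasWirtinger h.isOpen hw

theorem hasWirtinger_conj_dzbar_snd (h : IsDiracSpinor H Ω a b) (hw : w ∈ Ω) :
    HasWirtinger (fun u => conj (dzbar b u)) (conj (dzbar (dzbar b) w))
      (conj (dz (dzbar b) w)) w :=
  ((h.smooth_snd.dzbar h.isOpen).hasWirtinger h.isOpen hw).conjugate

/-- The Gauss equation. -/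
theorem gauss (h : IsDiracSpinor H Ω a b) {α : ℂ → ℝ} {A : ℂ}
    (hα : ∀ w ∈ Ω, α w = Real.log (‖a w‖ ^ 2 + ‖b w‖ ^ 2)) (hw : w ∈ Ω)
    (hA : A = conj (b w) * dz a w - a w * conj (dzbar b w) + I * a w ^ 2 * conj (b w) ^ 2) :
    dzbar (dz fun u => (α u : ℂ)) w -
        A * conj A / (a w * conj (a w) + b w * conj (b w)) ^ 2 +
        1 / 4 * (a w * conj (a w) + b w * conj (b w)) ^ 2 * H w ^ 2 =
      3 / 16 * (a w * conj (a w) + b w * conj (b w)) ^ 2 -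
        a w * conj (b w) * (conj (a w) * b w) := by
  have ha := h.hasWirtinger_fst hw
  have hb := h.hasWirtinger_snd hw
  have he : (dz fun u => (α u : ℂ)) =ᶠ[𝓝 w]
      fun u => spinorT a b u / (a u * conj (a u) + b u * conj (b u)) := by
    filter_upwards [h.isOpen.mem_nhds hw] with u hu using (h.hasWirtinger_log hα hu).dz_eq
  have hT := ((ha.conjugate.mul (h.hasWirtinger_dz_fst hw)).add
    (hb.mul (h.hasWirtinger_conj_dzbar_snd hw))).sub
    (((h.hasWirtinger_difference hw).const_mul (I / 2)).mul (ha.mul hb.conjugate))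
  have hT' := (hT.div (h.hasWirtinger_factor hw) (h.ne_zero' hw)).congr_of_eventuallyEq he
  have h0 := h.ne_zero' hw
  -- What remains is a rational identity in a, b, their first derivatives, H and H_z, with
  -- conjugates treated as independent variables.
  rw [hT'.dzbar_eq, h.dzbar_dz_fst hw, h.conj_dz_dzbar_snd hw, hA]
  simp only [spinorT, map_mul, map_neg, conj_potential, map_add, map_sub, map_div₀, conj_conj,
      conj_I, map_ofNat, map_pow, conj_ofReal]
  rw [nilPotential_eq]
  clear ha hb hT hT' he hα hA
  generalize conj (a w) = a' at *
  generalize conj (b w) = b' at *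
  generalize a w = a at *
  generalize b w = b at *
  have h0' : a' * a + b * b' ≠ 0 := by rwa [mul_comm a']
  field_simp
  ring_nf
  simp only [I_sq]
  ring

/-- The Codazzi equation. -/
theorem codazzi (h : IsDiracSpinor H Ω a b) {A : ℂ → ℂ} (hw : w ∈ Ω)
    (hA : ∀ w ∈ Ω, A w = conj (b w) * dz a w - a w * conj (dzbar b w) +
      I * a w ^ 2 * conj (b w) ^ 2) :
    dzbar (fun u => A u + (a u * conj (b u)) ^ 2 / (2 * (H u : ℂ) + I)) w =
      1 / 2 * dz (fun u => (H u : ℂ)) w * (a w * conj (a w) + b w * conj (b w)) ^ 2 +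
        dzbar (fun u => 1 / (2 * (H u : ℂ) + I)) w * (a w * conj (b w)) ^ 2 := by
  have ha := h.hasWirtinger_fst hw
  have hb := h.hasWirtinger_snd hw
  have hK := ((h.hasWirtinger_H hw).const_mul 2).add (HasWirtinger.const I w)
  have hK0 : (2 * (H w : ℂ) + I) ≠ 0 := fun h0 => by simpa using congrArg im h0
  have he : A =ᶠ[𝓝 w] fun u => conj (b u) * dz a u - a u * conj (dzbar b u) +
      I * (a u * conj (b u)) ^ 2 := by
    filter_upwards [h.isOpen.mem_nhds hw] with u hu
    rw [hA u hu]
    ring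
  have h1 := (((hb.conjugate.mul (h.hasWirtinger_dz_fst hw)).sub
    (ha.mul (h.hasWirtinger_conj_dzbar_snd hw))).add
      ((ha.mul hb.conjugate).sq.const_mul I)).congr_of_eventuallyEq he
  -- The derivatives of 1/(2H + i) on the two sides agree. The other occurrence of this factor
  -- disappears since ∂̄Z₃ = (2H + i)/4 · (|a|² + |b|²)(|b|² - |a|²).
  rw [(h1.add ((ha.mul hb.conjugate).sq.div hK hK0)).dzbar_eq,
    ((HasWirtinger.const 1 w).div hK hK0).dzbar_eq, h.dzbar_dz_fst hw, h.conj_dz_dzbar_snd hw]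
  simp only [spinorT, map_mul, map_neg, conj_potential]
  rw [nilPotential_eq]
  clear ha hb hK he h1 hA
  generalize conj (a w) = a' at *
  generalize conj (b w) = b' at *
  generalize a w = a at *
  generalize b w = b at *
  generalize (H w : ℂ) = k at *
  field_simp
  ring_nf
  simp only [I_sq, I_pow_three, I_pow_four]
  ring

/-- The Weingarten equations that are not part of the Dirac equation. -/
theorem weingarten (h : IsDiracSpinor H Ω a b) {α : ℂ → ℝ} {A : ℂ}
    (hα : ∀ w ∈ Ω, α w = Real.log (‖a w‖ ^ 2 + ‖b w‖ ^ 2)) (hw : w ∈ Ω)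
    (hA : A = conj (b w) * dz a w - a w * conj (dzbar b w) + I * a w ^ 2 * conj (b w) ^ 2) :
    dz a w = dz (fun u => (α u : ℂ)) w * a w +
        A * (a w * conj (a w) + b w * conj (b w))⁻¹ * b w - I / 2 * a w ^ 2 * conj (b w) ∧
      dzbar b w = -conj A * (a w * conj (a w) + b w * conj (b w))⁻¹ * a w +
        dzbar (fun u => (α u : ℂ)) w * b w - I / 2 * conj (a w) * b w ^ 2 := by
  have h0 := h.ne_zero' hw
  have hl := h.hasWirtinger_log hα hw
  -- `spinorT` and A are affine in ∂a and ∂b̄, with linear part (ā, b; b̄, -a) of determinant -(|a|²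
  -- + |b|²); the claim inverts this system.
  rw [hl.dz_eq, hl.dzbar_eq, hA]
  simp only [spinorT, map_mul, map_add, map_sub, map_div₀, conj_conj, conj_I, map_ofNat, map_pow]
  clear hl hA hα
  generalize conj (a w) = a' at *
  generalize conj (b w) = b' at *
  generalize a w = a at *
  generalize b w = b at *
  have h0' : a' * a + b * b' ≠ 0 := by rwa [mul_comm a']
  constructor <;>
  · field_simp
    ring

end IsDiracSpinor

variable {f : ℂ → Nil} {Ω : Set ℂ} {ψ₁ ψ₂ : ℂ → ℂ} {w : ℂ}

theorem IsSurface.norm_sq_ne_zero (hf : IsSurface f Ω) (hΩ : IsOpen Ω)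
    (h : IsGeneratingSpinor f Ω ψ₁ ψ₂) (hw : w ∈ Ω) : ‖ψ₁ w‖ ^ 2 + ‖ψ₂ w‖ ^ 2 ≠ 0 := fun h0 => by
  have h1 := (hf.2 w hw).1
  rw [(h.nilMetric_eq hf.1 hΩ hw).1, h0] at h1
  norm_num at h1

theorem IsSurface.nilDirac (hf : IsSurface f Ω) (hΩ : IsOpen Ω)
    (h : IsGeneratingSpinor f Ω ψ₁ ψ₂) (hw : w ∈ Ω) : NilDirac (meanCurvature f) ψ₁ ψ₂ w := by
  have h0 := hf.norm_sq_ne_zero hΩ h hw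
  have mc := h.meanCurvature_mul hf.1 hΩ hw h0
  obtain ⟨m0, m1, m2⟩ := hf.1.maurerCartan hΩ hw
  rw [(h.hasWirtinger_coord_Psi hΩ hw 0).dzbar_eq] at m0
  rw [(h.hasWirtinger_coord_Psi hΩ hw 1).dzbar_eq] at m1
  rw [(h.hasWirtinger_coord_Psi hΩ hw 2).dzbar_eq, h.coord_Psi hw] at m2
  have h0' : ψ₁ w * conj (ψ₁ w) + ψ₂ w * conj (ψ₂ w) ≠ 0 := by
    rw [← ofReal_norm_sq_add]
    exact ofReal_ne_zero.mpr h0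
  rw [ofReal_norm_sq_add] at mc
  simp only [spinorZ, star_def, Matrix.cons_val_zero, Matrix.cons_val_one, Matrix.cons_val,
    map_mul, map_add, map_sub, map_div₀, map_pow, conj_conj, conj_I, map_ofNat, map_one]
    at m0 m1 m2
  -- The first two Maurer-Cartan equations combine into this single complex equation.
  have e1 : ψ₂ w * dz ψ₂ w + ψ₁ w * dzbar ψ₁ w = 0 := by
    linear_combination I / 2 * m0 + 1 / 2 * m1 + (ψ₂ w * dz ψ₂ w + conj (ψ₁ w) *
      conj (dzbar ψ₁ w) + conj (ψ₂ w) * conj (dz ψ₂ w) + ψ₁ w * dzbar ψ₁ w) / 2 * I_sq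
  -- The real part is the mean curvature formula, the imaginary part the third Maurer-Cartan
  -- equation. With `e1` this is a linear system of determinant |ψ₁|² + |ψ₂|².
  have e2 : conj (ψ₂ w) * dzbar ψ₁ w - conj (ψ₁ w) * dz ψ₂ w =
      nilPotential (meanCurvature f) ψ₁ ψ₂ w *
        (ψ₁ w * conj (ψ₁ w) + ψ₂ w * conj (ψ₂ w)) := by
    rw [nilPotential_eq]
    linear_combination 1 / 2 * m2 - 1 / 2 * mc
  rw [nilDirac_iff]
  constructor
  · apply mul_left_cancel₀ h0'
    linear_combination conj (ψ₂ w) * e1 - ψ₁ w * e2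
  · apply mul_left_cancel₀ h0'
    linear_combination conj (ψ₁ w) * e1 + ψ₂ w * e2

theorem IsSurface.isDiracSpinor (hf : IsSurface f Ω) (hΩ : IsOpen Ω)
    (h : IsGeneratingSpinor f Ω ψ₁ ψ₂) : IsDiracSpinor (meanCurvature f) Ω ψ₁ ψ₂ where
  isOpen := hΩ
  smooth_fst := h.1
  smooth_snd := h.2.1
  -- H is the right-hand side of `meanCurvature_mul` divided by e^{2α}, hence smooth.
  smooth_H := by
    have hr : ContDiffOn ℝ ∞ (fun u => ψ₁ u * conj (ψ₁ u) + ψ₂ u * conj (ψ₂ u)) Ω :=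
      (h.1.mul h.1.conjugate).add (h.2.1.mul h.2.1.conjugate)
    have h0 : ∀ u ∈ Ω, (ψ₁ u * conj (ψ₁ u) + ψ₂ u * conj (ψ₂ u)) ^ 2 ≠ 0 := fun u hu => by
      rw [← ofReal_norm_sq_add]
      exact pow_ne_zero 2 (ofReal_ne_zero.mpr (hf.norm_sq_ne_zero hΩ h hu))
    have hp := h.1.dzbar hΩ
    have hq := h.2.1.dz hΩ
    refine ((((h.2.1.conjugate.mul hp).sub (h.1.conjugate.mul hq)).add
      ((h.2.1.mul hp.conjugate).sub (h.1.mul hq.conjugate))).mul ((hr.pow 2).inv h0)).congr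
      fun u hu => ?_
    have mc := h.meanCurvature_mul hf.1 hΩ hu (hf.norm_sq_ne_zero hΩ h hu)
    rw [ofReal_norm_sq_add] at mc
    exact (eq_mul_inv_iff_mul_eq₀ (h0 u hu)).mpr mc
  dirac := fun _ hw => hf.nilDirac hΩ h hw
  ne_zero := fun _ hw => hf.norm_sq_ne_zero hΩ h hw

theorem IsSurface.alpha_eq (hf : IsSurface f Ω) (hΩ : IsOpen Ω)
    (h : IsGeneratingSpinor f Ω ψ₁ ψ₂) (hw : w ∈ Ω) :
    alpha f w = Real.log (‖ψ₁ w‖ ^ 2 + ‖ψ₂ w‖ ^ 2) := by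
  rw [alpha, (h.nilMetric_eq hf.1 hΩ hw).1, Real.log_pow]
  push_cast
  ring

end

section

/-! ### The Weierstrass representation -/

theorem exists_nil (x y z : ℝ) : ∃ g : Nil, mat g = nilMatrix x y z :=
  ⟨⟨⟨nilMatrix x y z, by simp [nilMatrix, Matrix.det_fin_three]⟩, x, y, z, rfl⟩, rfl⟩

theorem mat_injective : Function.Injective mat := fun _ _ h =>
  Subtype.ext (Subtype.ext h)

variable {H : ℂ → ℝ} {Ω : Set ℂ} {ψ₁ ψ₂ : ℂ → ℂ}

/-- A solution of the Dirac equation generates a map to Nil. -/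
theorem exists_map_of_nilDirac (hΩ : IsOpen Ω) (hsc : IsSimplyConnected Ω)
    (h1 : ContDiffOn ℝ ∞ ψ₁ Ω) (h2 : ContDiffOn ℝ ∞ ψ₂ Ω) (hD : ∀ w ∈ Ω, NilDirac H ψ₁ ψ₂ w)
    (P : ℂ) (g : Nil) :
    ∃ f : ℂ → Nil, IsSmooth f Ω ∧ f P = g ∧ IsGeneratingSpinor f Ω ψ₁ ψ₂ := by
  have hZ : ∀ k, ContDiffOn ℝ ∞ (fun w => spinorZ (ψ₁ w) (ψ₂ w) k) Ω := fun k => by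
    fin_cases k
    · exact contDiffOn_const.mul ((h2.conjugate.pow 2).add (h1.pow 2))
    · exact contDiffOn_const.mul ((h2.conjugate.pow 2).sub (h1.pow 2))
    · exact h1.mul h2.conjugate
  -- Only values of the potential U enter, never its derivatives, so H may be an arbitrary real
  -- function.
  have hW1 : ∀ w ∈ Ω, HasWirtinger ψ₁ (dz ψ₁ w) (nilPotential H ψ₁ ψ₂ w * ψ₂ w) w :=
    fun w hw => (h1.hasWirtinger hΩ hw).congr_deriv rfl ((nilDirac_iff _ _ _ _).mp (hD w hw)).2
  have hW2 : ∀ w ∈ Ω, HasWirtinger (fun u => conj (ψ₂ u)) (conj (dzbar ψ₂ w))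
      (conj (-nilPotential H ψ₁ ψ₂ w * ψ₁ w)) w :=
    fun w hw => ((h2.hasWirtinger hΩ hw).congr_deriv
      ((nilDirac_iff _ _ _ _).mp (hD w hw)).1 rfl).conjugate
  have d0 : ∀ w ∈ Ω, dzbar (fun u => spinorZ (ψ₁ u) (ψ₂ u) 0) w = _ := fun w hw =>
    (((hW2 w hw).sq.add (hW1 w hw).sq).const_mul (I / 2)).dzbar_eq
  have d1 : ∀ w ∈ Ω, dzbar (fun u => spinorZ (ψ₁ u) (ψ₂ u) 1) w = _ := fun w hw =>
    (((hW2 w hw).sq.sub (hW1 w hw).sq).const_mul (1 / 2)).dzbar_eq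
  have d2 : ∀ w ∈ Ω, dzbar (fun u => spinorZ (ψ₁ u) (ψ₂ u) 2) w = _ := fun w hw =>
    ((hW1 w hw).mul (hW2 w hw)).dzbar_eq
  -- With s = Uψ₁ψ₂ one has ∂̄Z₁ = i(s - s̄) and ∂̄Z₂ = -(s + s̄), real for any U. The special form
  -- of U matters only for the third primitive.
  have r0 : ∀ w ∈ Ω, conj (dzbar (fun u => spinorZ (ψ₁ u) (ψ₂ u) 0) w) =
      dzbar (fun u => spinorZ (ψ₁ u) (ψ₂ u) 0) w := fun w hw => by
    rw [d0 w hw]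
    simp only [map_mul, map_add, map_neg, map_div₀, map_ofNat, conj_I, conj_conj]
    ring
  have r1 : ∀ w ∈ Ω, conj (dzbar (fun u => spinorZ (ψ₁ u) (ψ₂ u) 1) w) =
      dzbar (fun u => spinorZ (ψ₁ u) (ψ₂ u) 1) w := fun w hw => by
    rw [d1 w hw]
    simp only [map_mul, map_sub, map_neg, map_div₀, map_ofNat, map_one, conj_conj]
    ring
  obtain ⟨x, hx, hxP, hxd⟩ := exists_primitive hΩ hsc (hZ 0) r0 P (mat g 0 1)
  obtain ⟨y, hy, hyP, hyd⟩ := exists_primitive hΩ hsc (hZ 1) r1 P (mat g 1 2)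
  -- Z₃ = z_z - x y_z prescribes z_z = Z₃ + xZ₂. Closedness holds because Im ∂̄Z₃ = (|ψ₂|⁴ -
  -- |ψ₁|⁴)/4 cancels Im(Z̄₁Z₂).
  obtain ⟨z, hz, hzP, hzd⟩ := exists_primitive hΩ hsc
    ((hZ 2).add (hx.complex_ofReal.mul (hZ 1))) (fun w hw => by
      have e := (((hZ 2).hasWirtinger hΩ hw).add
        ((hxd w hw).mul ((hZ 1).hasWirtinger hΩ hw))).dzbar_eq
      rw [e, map_add, map_add, map_mul, map_mul, conj_conj, conj_ofReal, r1 w hw, d2 w hw]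
      simp only [spinorZ, star_def, Matrix.cons_val_zero, Matrix.cons_val_one, map_mul, map_neg,
        map_add, map_sub, map_div₀, map_pow, map_one, map_ofNat, conj_conj, conj_I,
        conj_ofReal, IsDiracSpinor.conj_potential]
      rw [nilPotential_eq]
      ring) P (mat g 0 2)
  choose f hf using fun w => exists_nil (x w) (y w) (z w)
  have f01 : ∀ w, mat (f w) 0 1 = x w := fun w => by simp [hf, nilMatrix]
  have f12 : ∀ w, mat (f w) 1 2 = y w := fun w => by simp [hf, nilMatrix]
  have f02 : ∀ w, mat (f w) 0 2 = z w := fun w => by simp [hf, nilMatrix]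
  refine ⟨f, fun i j => ?_, mat_injective ?_, h1, h2, fun w hw => ?_⟩
  · simp only [hf]
    fin_cases i <;> fin_cases j <;> simp [nilMatrix, contDiffOn_const, hx, hy, hz]
  · rw [hf, hxP, hyP, hzP, ← mat_eq_nilMatrix]
  · rw [Psi_eq_sum_iff, Psi_eq]
    simp only [f01, f12, f02, (hxd w hw).dz_eq, (hyd w hw).dz_eq, (hzd w hw).dz_eq]
    funext k
    fin_cases k <;> simp [coord]

/-- The mean curvature of a map generated by a solution of the Dirac equation. -/
theorem IsGeneratingSpinor.meanCurvature_eq {f : ℂ → Nil} (h : IsGeneratingSpinor f Ω ψ₁ ψ₂)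
    (hf : IsSmooth f Ω) (hΩ : IsOpen Ω) {w : ℂ} (hw : w ∈ Ω) (hD : NilDirac H ψ₁ ψ₂ w)
    (h0 : ‖ψ₁ w‖ ^ 2 + ‖ψ₂ w‖ ^ 2 ≠ 0) : meanCurvature f w = H w := by
  have h0' := ofReal_ne_zero.mpr h0
  have mc := h.meanCurvature_mul hf hΩ hw h0
  obtain ⟨e1, e2⟩ := (nilDirac_iff _ _ _ _).mp hD
  apply ofReal_injective
  apply mul_right_cancel₀ (pow_ne_zero 2 h0')
  rw [mc, e1, e2, ofReal_norm_sq_add, map_mul, map_mul, map_neg, IsDiracSpinor.conj_potential,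
    nilPotential_eq]
  ring

end

end NilSurface

end

/-! ### Assembly of both directions -/

theorem mainTheorem1 :
    (∀ (Ω : Set ℂ) (f : ℂ → NilSurface.Nil), IsOpen Ω → NilSurface.IsSurface f Ω →
      (IsSimplyConnected Ω → ∃ ψ₁ ψ₂ : ℂ → ℂ, NilSurface.IsGeneratingSpinor f Ω ψ₁ ψ₂) ∧
      ∀ ψ₁ ψ₂ : ℂ → ℂ, NilSurface.IsGeneratingSpinor f Ω ψ₁ ψ₂ →
        let H : ℂ → ℝ := NilSurface.meanCurvature f
        let α : ℂ → ℝ := NilSurface.alpha f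
        let A : ℂ → ℂ := NilSurface.hopf f
        let Z₃ : ℂ → ℂ := fun w => ψ₁ w * star (ψ₂ w)
        ∀ w ∈ Ω,
          -- the conformal factor
          Real.exp (α w) = ‖ψ₁ w‖ ^ 2 + ‖ψ₂ w‖ ^ 2 ∧
          -- the Dirac equation
          NilSurface.NilDirac H ψ₁ ψ₂ w ∧
          -- the other Weingarten equations
          NilSurface.dz ψ₁ w = NilSurface.dz (fun u => (α u : ℂ)) w * ψ₁ w +
            A w * (Real.exp (-α w) : ℂ) * ψ₂ w - Complex.I / 2 * ψ₁ w ^ 2 * star (ψ₂ w) ∧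
          NilSurface.dzbar ψ₂ w = -star (A w) * (Real.exp (-α w) : ℂ) * ψ₁ w +
            NilSurface.dzbar (fun u => (α u : ℂ)) w * ψ₂ w -
            Complex.I / 2 * star (ψ₁ w) * ψ₂ w ^ 2 ∧
          -- the Hopf differential
          A w = (star (ψ₂ w) * NilSurface.dz ψ₁ w -
              ψ₁ w * NilSurface.dz (fun u => star (ψ₂ u)) w) +
            Complex.I * ψ₁ w ^ 2 * star (ψ₂ w) ^ 2 ∧
          -- the Codazzi equations
          NilSurface.dzbar (fun u => NilSurface.dz (fun v => (α v : ℂ)) u) w -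
              (Real.exp (-2 * α w) : ℂ) * (‖A w‖ : ℂ) ^ 2 +
              1 / 4 * (Real.exp (2 * α w) : ℂ) * (H w : ℂ) ^ 2 =
            3 / 16 * (Real.exp (2 * α w) : ℂ) - (‖Z₃ w‖ : ℂ) ^ 2 ∧
          NilSurface.dzbar (fun u => A u + Z₃ u ^ 2 / (2 * (H u : ℂ) + Complex.I)) w =
            1 / 2 * NilSurface.dz (fun u => (H u : ℂ)) w * (Real.exp (2 * α w) : ℂ) +
              NilSurface.dzbar (fun u => 1 / (2 * (H u : ℂ) + Complex.I)) w * Z₃ w ^ 2) ∧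
    (∀ (Ω : Set ℂ) (H : ℂ → ℝ) (ψ₁ ψ₂ : ℂ → ℂ), IsOpen Ω → IsSimplyConnected Ω →
      ContDiffOn ℝ ∞ ψ₁ Ω → ContDiffOn ℝ ∞ ψ₂ Ω →
      (∀ w ∈ Ω, NilSurface.NilDirac H ψ₁ ψ₂ w) →
      ∀ P ∈ Ω, ∀ g : NilSurface.Nil, ∃ f : ℂ → NilSurface.Nil,
        NilSurface.IsSmooth f Ω ∧ f P = g ∧ NilSurface.IsGeneratingSpinor f Ω ψ₁ ψ₂ ∧
        -- away from the zeros of `ψ` the map `f` is a conformal immersion of mean curvature `H`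
        ∀ w ∈ Ω, (ψ₁ w ≠ 0 ∨ ψ₂ w ≠ 0) →
          NilSurface.IsConformalAt f w ∧ NilSurface.meanCurvature f w = H w) := by
  refine ⟨fun Ω f hΩ hf => ⟨fun hsc => hf.exists_spinor hΩ hsc, fun ψ₁ ψ₂ h => ?_⟩,
    fun Ω H ψ₁ ψ₂ hΩ hsc h1 h2 hD P _ g => ?_⟩
  · intro H α A Z₃ w hw
    have hS := hf.isDiracSpinor hΩ h
    have h0 := hS.ne_zero w hw
    have hpos : 0 < ‖ψ₁ w‖ ^ 2 + ‖ψ₂ w‖ ^ 2 := lt_of_le_of_ne (by positivity) h0.symm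
    have hα : ∀ w ∈ Ω, α w = Real.log (‖ψ₁ w‖ ^ 2 + ‖ψ₂ w‖ ^ 2) := fun w hw =>
      hf.alpha_eq hΩ h hw
    have hA : ∀ w ∈ Ω, A w = _ := fun w hw => h.hopf_eq hf.1 hΩ hw (hS.ne_zero w hw)
    have hexp : Real.exp (α w) = ‖ψ₁ w‖ ^ 2 + ‖ψ₂ w‖ ^ 2 := by
      rw [hα w hw, Real.exp_log hpos]
    have hexp1 : (Real.exp (-α w) : ℂ) = (ψ₁ w * starRingEnd ℂ (ψ₁ w) +
        ψ₂ w * starRingEnd ℂ (ψ₂ w))⁻¹ := by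
      rw [Real.exp_neg, hexp, Complex.ofReal_inv, NilSurface.ofReal_norm_sq_add]
    have hexp2 : (Real.exp (2 * α w) : ℂ) = (ψ₁ w * starRingEnd ℂ (ψ₁ w) +
        ψ₂ w * starRingEnd ℂ (ψ₂ w)) ^ 2 := by
      rw [two_mul, Real.exp_add, hexp, ← NilSurface.ofReal_norm_sq_add]
      push_cast
      ring
    have hexp3 : (Real.exp (-2 * α w) : ℂ) = ((ψ₁ w * starRingEnd ℂ (ψ₁ w) +
        ψ₂ w * starRingEnd ℂ (ψ₂ w)) ^ 2)⁻¹ := by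
      rw [neg_mul, Real.exp_neg, Complex.ofReal_inv, hexp2]
    obtain ⟨w1, w2⟩ := hS.weingarten hα hw (hA w hw)
    refine ⟨hexp, hf.nilDirac hΩ h hw, ?_, ?_, ?_, ?_, ?_⟩
    · rw [hexp1]
      exact w1
    · rw [hexp1]
      exact w2
    · have hs := (h.2.1.hasWirtinger hΩ hw).conjugate.dz_eq
      rw [hA w hw]
      simp only [Complex.star_def]
      rw [hs]
    · have hg := hS.gauss hα hw (hA w hw)
      have hZ : (‖Z₃ w‖ : ℂ) ^ 2 = ψ₁ w * starRingEnd ℂ (ψ₂ w) *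
          (starRingEnd ℂ (ψ₁ w) * ψ₂ w) := by
        rw [NilSurface.ofReal_norm_sq]
        simp only [Z₃, Complex.star_def, map_mul, Complex.conj_conj]
      rw [hZ, hexp2, hexp3, NilSurface.ofReal_norm_sq]
      linear_combination hg
    · rw [hexp2]
      exact hS.codazzi hw hA
  · obtain ⟨f, hf, hP, hψ⟩ := NilSurface.exists_map_of_nilDirac hΩ hsc h1 h2 hD P g
    refine ⟨f, hf, hP, hψ, fun w hw h0 => ?_⟩
    have hpos : 0 < ‖ψ₁ w‖ ^ 2 + ‖ψ₂ w‖ ^ 2 := by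
      rcases h0 with h0 | h0
      · have := norm_pos_iff.mpr h0
        positivity
      · have := norm_pos_iff.mpr h0
        positivity
    obtain ⟨hE, hG, hF⟩ := hψ.nilMetric_eq hf hΩ hw
    refine ⟨⟨?_, hE.trans hG.symm, hF⟩, hψ.meanCurvature_eq hf hΩ hw (hD w hw) hpos.ne'⟩
    rw [hE]
    positivity
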